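/- Let $K$ be a field and let $G$ be a finite simple graph with vertex set $V$. Let $S = K[x_v : v \in V]$ with the standard grading, and let $I(\bar G) \subset S$ be the ideal generated by the monomials $x_u x_v$, where $\{u,v\}$ runs over the pairs of distinct non-adjacent vertices of $G$. A graph is called *chordal* if every cycle of length greater than $3$ in it has a chord. For a nonzero homogeneous ideal $I$ of $S$ with graded Betti numbers $\beta_{i,j}(I)$ (the minimal graded free resolution of $I$ has $F_i = \bigoplus_j S(-j)^{\beta_{i,j}(I)}$) put $\mathrm{reg}(I) = \sup\{j-i : \beta_{i,j}(I) \neq 0\}$, and let $\mathrm{indeg}(I)$ be the least degree of a nonzero homogeneous element of $I$; $I$ has a *$2$-linear resolution* if $\mathrm{reg}(I) = 2 = \mathrm{indeg}(I)$. A graph $C$ is *minimal to $2$-linearity* if $I(\bar C)$ does not have a $2$-linear resolution, $I(\bar H)$ has a $2$-linear resolution for every graph $H$ on the same vertex set whose edge set is a proper subset of that of $C$, and the clique complex of $C$ has dimension $1$. Then: 1. (Fröberg) If $G$ is not complete, then $I(\bar G)$ has a $2$-linear resolution if and only if $G$ is chordal. (If $G$ is complete, then $I(\bar G) = 0$ and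 $G$ is chordal.) 2. $G$ is not chordal if and only if it contains an induced subgraph isomorphic to the cycle $C_n$ for some $n > 3$. 3. For every $n > 3$, the cycle $C_n$ is minimal to $2$-linearity (over $K$). 4. (Dirac) If $G$ is chordal and not complete, then there are proper subsets $A, B \subsetneq V$ with $A \cup B = V$ such that every edge of $G$ lies in $A$ or in $B$, the set $A \cap B$ is a clique of $G$, and the induced subgraphs of $G$ on $A$ and on $B$ are chordal. -/

import Mathlib

open MvPolynomial

noncomputable section

/-- The ideal `I(G)` of a simple graph `G`, generated by the monomials `x_u x_v` over the
edges `{u, v}` of `G`, in the polynomial ring with one variable for each vertex. -/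
def SimpleGraph.edgeIdeal {V : Type*} (K : Type*) [Field K] (G : SimpleGraph V) :
    Ideal (MvPolynomial V K) :=
  Ideal.span {f | ∃ u v : V, G.Adj u v ∧ f = X u * X v}

/-- The circuit ideal `I(Ḡ)` of a graph `G`: the ideal generated by the `x_u x_v` over the
pairs of distinct vertices which are not edges of `G`. -/
def SimpleGraph.circuitIdeal {V : Type*} (K : Type*) [Field K] (G : SimpleGraph V) :
    Ideal (MvPolynomial V K) :=
  Gᶜ.edgeIdeal K

/-- A minimal graded free resolution `⋯ → F₂ → F₁ → F₀ → I → 0` of an ideal `I` of the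
standard graded polynomial ring `S`. The free module `F_i` has a finite basis of `rank i`
elements, the `b`-th of which is homogeneous of degree `deg i b`, so that
`F_i = ⨁_b S(-deg i b)`. The map `F₀ → I` sends the basis to `gen`, and the map
`F_{i+1} → F_i` is given by the matrix `diff i`; all maps are homogeneous of degree zero.
Minimality: the image of `F_{i+1}` lies in `𝔪 F_i`, where `𝔪` is generated by the variables.
(All modules involved live in non-negative degrees, so that degrees are natural numbers.) -/
structure MinimalGradedFreeResolution {σ K : Type*} [Field K]
    (I : Ideal (MvPolynomial σ K)) where
  rank : ℕ → ℕ
  deg : (i : ℕ) → Fin (rank i) → ℕ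
  gen : Fin (rank 0) → MvPolynomial σ K
  diff : (i : ℕ) → Matrix (Fin (rank i)) (Fin (rank (i + 1))) (MvPolynomial σ K)
  gen_isHomogeneous : ∀ b, (gen b).IsHomogeneous (deg 0 b)
  diff_isHomogeneous : ∀ i a b, diff i a b ≠ 0 →
    ∃ e, deg i a + e = deg (i + 1) b ∧ (diff i a b).IsHomogeneous e
  span_gen : Ideal.span (Set.range gen) = I
  exact_zero : Function.Exact (diff 0).mulVecLin
    (Fintype.linearCombination (MvPolynomial σ K) gen)
  exact_succ : ∀ i, Function.Exact (diff (i + 1)).mulVecLin (diff i).mulVecLin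
  minimal : ∀ i a b, constantCoeff (diff i a b) = 0

/-- The graded Betti number `β_{i,j}`: the number of summands `S(-j)` of `F_i`. -/
def MinimalGradedFreeResolution.betti {σ K : Type*} [Field K] {I : Ideal (MvPolynomial σ K)}
    (F : MinimalGradedFreeResolution I) (i j : ℕ) : ℕ :=
  (Finset.univ.filter fun b => F.deg i b = j).card

/-- `reg(I) = r`, where `reg(I) = sup {j - i : β_{i,j}(I) ≠ 0}`. The Betti numbers are read off
a minimal graded free resolution; these are unique up to isomorphism, so the choice does not
matter. The zero ideal has no regularity. -/
def HasRegularity {σ K : Type*} [Field K] (I : Ideal (MvPolynomial σ K)) (r : ℤ) : Prop :=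
  ∃ F : MinimalGradedFreeResolution I,
    IsLUB {m : ℤ | ∃ i j : ℕ, F.betti i j ≠ 0 ∧ m = (j : ℤ) - (i : ℤ)} r

/-- `indeg(I) = d`, where `indeg(I)` is the least degree of a nonzero homogeneous
element of `I`. -/
def HasInitialDegree {σ K : Type*} [Field K] (I : Ideal (MvPolynomial σ K)) (d : ℕ) : Prop :=
  IsLeast {k : ℕ | ∃ f ∈ I, f ≠ 0 ∧ f.IsHomogeneous k} d

/-- `I` has a `d`-linear resolution: `reg(I) = d = indeg(I)`. In particular `I ≠ 0`. -/
def HasLinearResolution {σ K : Type*} [Field K] (I : Ideal (MvPolynomial σ K)) (d : ℕ) : Prop :=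
  HasRegularity I (d : ℤ) ∧ HasInitialDegree I d

/-- A graph is chordal if each of its cycles of length greater than three has a chord. -/
def SimpleGraph.IsChordal {V : Type*} (G : SimpleGraph V) : Prop :=
  ∀ (v : V) (c : G.Walk v v), c.IsCycle → 3 < c.length → ¬ c.IsChordless

/-- The clique complex `Δ(G)`: its faces are the finite sets of pairwise adjacent vertices. -/
def SimpleGraph.cliqueComplex {V : Type*} (G : SimpleGraph V) : Set (Finset V) :=
  {F | G.IsClique (F : Set V)}

/-- The simplicial complex `Δ` has dimension `m`: this is the largest dimension `|F| - 1`
of a face `F`. -/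
def HasDimension {V : Type*} (Δ : Set (Finset V)) (m : ℤ) : Prop :=
  IsGreatest {k : ℤ | ∃ F ∈ Δ, k = (F.card : ℤ) - 1} m

/-- The graph `G` is minimal to `2`-linearity over `K`: `I(Ḡ)` does not have a `2`-linear
resolution, `I(H̄)` has one for every graph `H` on the same vertices whose edges form a proper
subset of those of `G`, and the clique complex of `G` has dimension one. -/
def SimpleGraph.IsMinimalToTwoLinearity {V : Type*} (K : Type*) [Field K]
    (G : SimpleGraph V) : Prop :=
  ¬ HasLinearResolution (G.circuitIdeal K) 2 ∧
  (∀ H : SimpleGraph V, H < G → HasLinearResolution (H.circuitIdeal K) 2) ∧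
  HasDimension G.cliqueComplex 1

/-- `G` is the union of its proper induced subgraphs on the vertex sets `A` and `B`, which
meet in a clique. -/
structure SimpleGraph.IsCliqueDecomposition {V : Type*} (G : SimpleGraph V)
    (A B : Set V) : Prop where
  left_ne_univ : A ≠ Set.univ
  right_ne_univ : B ≠ Set.univ
  union_eq_univ : A ∪ B = Set.univ
  adj : ∀ u v, G.Adj u v → (u ∈ A ∧ v ∈ A) ∨ (u ∈ B ∧ v ∈ B)
  isClique_inter : G.IsClique (A ∩ B)

end

/-! A chordless cycle of length n is an induced copy of `cycleGraph n`, so chordality excludes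
exactly these copies for n > 3. In a chordal graph, the neighbours of x bordering the component of a
non-neighbour y form a clique: two non-adjacent ones, joined by a shortest path through that
component, would close up with x to a long induced cycle. This gives Dirac's decomposition
(`exists_clique_separator`) and simplicial vertices (`exists_simplicial`).

Chordal implies linear by deleting a simplicial vertex v. The circuit ideal is J + x_v P, where J
belongs to the remaining vertices and P is generated by the variables of the non-neighbours of v.
Simpliciality gives J ≤ P, and x_v is a nonzerodivisor modulo J, so linear resolutions of J and P
combine in a mapping cone (`nonempty_sup_span_mul`).

Conversely, regularity 2 bounds the degrees in a minimal resolution of I. A zigzag between that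
resolution and the Koszul complex shows that Koszul cycles modulo I of homological degree m > 0 and
internal degree at least m + 2 are boundaries modulo I (`exists_sub_d_mem`). An induced cycle on W
with an edge uv gives the Koszul cycle x_u x_v e_{W∖{u,v}}. It is not a boundary: a signed sum of
coefficients over the edges of the cycle vanishes on I, telescopes to zero on boundaries, and is ±1
here (`not_hasRegularity_circuitIdeal`).

Cycles are minimal to 2-linearity because a proper subgraph of a cycle contains no cycle at all
(`cycleGraph_le_of_hom`), hence is chordal. -/

namespace SimpleGraph

/-! ### Chordless cycles as induced subgraphs -/

variable {V : Type*} {G : SimpleGraph V}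

theorem cycleGraph_adj_iff_of_lt {n : ℕ} {i j : Fin n} (h : i < j) :
    (cycleGraph n).Adj i j ↔ (j : ℕ) = i + 1 ∨ ((i : ℕ) = 0 ∧ (j : ℕ) + 1 = n) := by
  rw [cycleGraph_adj', Fin.coe_sub_iff_lt.2 h, Fin.coe_sub_iff_le.2 h.le]
  have := i.2
  have := j.2
  rw [Fin.lt_def] at h
  omega

/-- Indexing by natural numbers and testing only i < j replaces arithmetic modulo n by the single
exceptional pair (0, n - 1). -/
theorem nonempty_cycleGraph_embedding {n : ℕ} (g : ℕ → V)
    (hinj : ∀ i j, i < j → j < n → g i ≠ g j)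
    (hadj : ∀ i j, i < j → j < n → (G.Adj (g i) (g j) ↔ j = i + 1 ∨ (i = 0 ∧ j + 1 = n))) :
    Nonempty (cycleGraph n ↪g G) := by
  refine ⟨⟨⟨fun i => g i, fun i j hij => ?_⟩, fun {i j} => ?_⟩⟩
  · rcases lt_trichotomy i j with h | h | h
    · exact absurd hij (hinj i j h j.2)
    · exact h
    · exact absurd hij.symm (hinj j i h i.2)
  · change G.Adj (g i) (g j) ↔ _
    rcases lt_trichotomy i j with h | h | h
    · rw [hadj i j h j.2, cycleGraph_adj_iff_of_lt h]
    · subst h; simp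
    · rw [G.adj_comm, (cycleGraph n).adj_comm, hadj j i h i.2, cycleGraph_adj_iff_of_lt h]

theorem Walk.IsCycle.nonempty_cycleGraph_embedding {v : V} {c : G.Walk v v} (hc : c.IsCycle)
    (hch : c.IsChordless) : Nonempty (cycleGraph c.length ↪g G) := by
  have h3 := hc.three_le_length
  have inj : ∀ i j, i < c.length → j < c.length → c.getVert i = c.getVert j → i = j :=
    fun i j hi hj h => hc.getVert_injOn' (by simp; omega) (by simp; omega) h
  refine SimpleGraph.nonempty_cycleGraph_embedding c.getVert
    (fun i j hij hj h => hij.ne (inj i j (hij.trans hj) hj h)) fun i j hij hj => ⟨fun h => ?_, ?_⟩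
  · have he := hch.mem_edges (c.getVert_mem_support i) (c.getVert_mem_support j) h
    obtain ⟨k, hk, hk'⟩ := List.getElem_of_mem he
    rw [Walk.length_edges] at hk
    rw [Walk.getElem_edges] at hk'
    have last : k + 1 = c.length → c.getVert (k + 1) = c.getVert 0 := fun h => by
      rw [h]; simp
    -- The base vertex occurs at indices 0 and `c.length`; the second alternative is the closing
    -- edge.
    have next : ∀ m < c.length, c.getVert (k + 1) = c.getVert m →
        m = k + 1 ∨ (k + 1 = c.length ∧ m = 0) := fun m hm h => by
      by_cases hk1 : k + 1 < c.length
      · exact Or.inl (inj _ _ hk1 hm h).symm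
      · have : k + 1 = c.length := by omega
        exact Or.inr ⟨this, (inj _ _ (by omega) hm ((last this).symm.trans h)).symm⟩
    rcases Sym2.eq_iff.1 hk' with ⟨h1, h2⟩ | ⟨h1, h2⟩
    · have := inj _ _ hk (hij.trans hj) h1
      have := next j hj h2
      omega
    · have := inj _ _ hk hj h1
      have := next i (hij.trans hj) h2
      omega
  · rintro (rfl | ⟨rfl, h⟩)
    · exact c.adj_getVert_succ (by omega)
    · have := c.adj_getVert_succ (i := j) hj
      rw [h, c.getVert_length] at this
      simpa using this.symm

theorem cycleGraph.mem_edges_cycle {n : ℕ} {a b : Fin (n + 3)}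
    (h : (cycleGraph (n + 3)).Adj a b) : s(a, b) ∈ (cycleGraph.cycle n).edges := by
  have key : ∀ k < n + 3, s((cycleGraph.cycle n).getVert k, (cycleGraph.cycle n).getVert (k + 1))
      ∈ (cycleGraph.cycle n).edges := fun k hk => by
    rw [← Walk.getElem_edges (by simpa using hk)]
    exact List.getElem_mem _
  wlog hab : a < b generalizing a b
  · rw [Sym2.eq_swap]
    exact this h.symm (lt_of_le_of_ne (not_lt.1 hab) h.ne')
  have ha := a.2
  have hb := b.2
  rw [Fin.lt_def] at hab
  rcases (cycleGraph_adj_iff_of_lt hab).1 h with h | ⟨h0, h⟩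
  -- `cycleGraph.cycle` runs downwards: its vertex at index k is n + 3 - k modulo n + 3.
  · have := key (n + 3 - b) (by omega)
    rw [cycleGraph.getVert_cycle (by omega), cycleGraph.getVert_cycle (by omega),
      Sym2.eq_swap] at this
    convert this
    · rw [show n + 3 - (n + 3 - (b : ℕ) + 1) = a by omega, Nat.mod_eq_of_lt ha]
    · rw [show n + 3 - (n + 3 - (b : ℕ)) = b by omega, Nat.mod_eq_of_lt hb]
  · have := key 0 (by omega)
    rw [cycleGraph.getVert_cycle (by omega), cycleGraph.getVert_cycle (by omega)] at this
    convert this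
    · simp [h0]
    · rw [show n + 3 - (0 + 1) = b by omega, Nat.mod_eq_of_lt hb]

theorem isChordal_iff_isEmpty_embedding :
    G.IsChordal ↔ ∀ n, 3 < n → IsEmpty (cycleGraph n ↪g G) := by
  refine ⟨fun h n hn => ⟨fun f => ?_⟩, fun h v c hc h3 hch => ?_⟩
  · obtain ⟨n, rfl⟩ : ∃ k, n = k + 3 := ⟨n - 3, by omega⟩
    refine h _ ((cycleGraph.cycle n).map f.toHom)
      ((Walk.isCycle_map_iff_of_injective f.injective).2 cycleGraph.isCycle_cycle)
      (by simpa using hn) ?_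
    rw [Walk.isChordless_iff_forall_mem_edges]
    intro u w hu hw huw
    rw [Walk.support_map, List.mem_map] at hu hw
    obtain ⟨a, -, rfl⟩ := hu
    obtain ⟨b, -, rfl⟩ := hw
    rw [Walk.edges_map, List.mem_map]
    exact ⟨s(a, b), cycleGraph.mem_edges_cycle (f.map_adj_iff.1 huw), rfl⟩
  · exact (not_isEmpty_iff.2 (hc.nonempty_cycleGraph_embedding hch)) (h _ h3)

theorem IsChordal.of_embedding {W : Type*} {H : SimpleGraph W} (hG : G.IsChordal) (f : H ↪g G) :
    H.IsChordal := by
  rw [isChordal_iff_isEmpty_embedding] at hG ⊢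
  exact fun n hn => ⟨fun g => (hG n hn).false (g.trans f)⟩

/-! ### Clique separators and simplicial vertices -/

/-- A shortest such walk is an induced path whose inner vertices avoid x and its neighbours. If s
and t were not adjacent, its length would be at least 2, and x would close it to an induced cycle of
length at least 4. -/
theorem IsChordal.adj_of_walk (hG : G.IsChordal) {x s t : V} (hs : G.Adj x s) (ht : G.Adj x t)
    (hst : s ≠ t) (p : G.Walk s t)
    (hp : ∀ v ∈ p.support, v = s ∨ v = t ∨ (v ≠ x ∧ ¬ G.Adj x v)) : G.Adj s t := by
  by_contra hna
  obtain ⟨p, hp, hmin⟩ : ∃ p : G.Walk s t,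
      (∀ v ∈ p.support, v = s ∨ v = t ∨ (v ≠ x ∧ ¬ G.Adj x v)) ∧
      ∀ q : G.Walk s t, (∀ v ∈ q.support, v = s ∨ v = t ∨ (v ≠ x ∧ ¬ G.Adj x v)) →
        p.length ≤ q.length := by
    obtain ⟨q, hq, hq'⟩ := (measure (fun q : G.Walk s t => q.length)).wf.has_min
      {q | ∀ v ∈ q.support, v = s ∨ v = t ∨ (v ≠ x ∧ ¬ G.Adj x v)} ⟨p, hp⟩
    exact ⟨q, hq, fun r hr => not_lt.1 (hq' r hr)⟩
  have htake : ∀ i, ∀ v ∈ (p.take i).support, v ∈ p.support := fun i v hv =>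
    (p.isSubwalk_take i).support_subset hv
  have hdrop : ∀ i, ∀ v ∈ (p.drop i).support, v ∈ p.support := fun i v hv =>
    (p.isSubwalk_drop i).support_subset hv
  -- By minimality, loops could be cut out, and chords (in `hcons`) used as shortcuts.
  have hinj : ∀ i j, i < j → j ≤ p.length → p.getVert i ≠ p.getVert j := fun i j hij hj h => by
    have := hmin (((p.take i).copy rfl h).append (p.drop j)) fun v hv => by
      rw [Walk.mem_support_append_iff, Walk.support_copy] at hv
      exact hp v (hv.elim (htake i v) (hdrop j v))
    simp at this
    omega
  have hcons : ∀ i j, i < j → j ≤ p.length → G.Adj (p.getVert i) (p.getVert j) → j = i + 1 :=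
    fun i j hij hj h => by
      have := hmin ((p.take i).append (Walk.cons h (p.drop j))) fun v hv => by
        rw [Walk.mem_support_append_iff, Walk.support_cons, List.mem_cons] at hv
        rcases hv with hv | rfl | hv
        · exact hp v (htake i v hv)
        · exact hp _ (p.getVert_mem_support i)
        · exact hp v (hdrop j v hv)
      simp at this
      omega
  have h2 : 2 ≤ p.length := by
    by_contra! h
    interval_cases hl : p.length
    · exact hst (Walk.eq_of_length_eq_zero hl)
    · exact hna (Walk.adj_of_length_eq_one hl)
  have hx : ∀ i, i ≤ p.length → (G.Adj (p.getVert i) x ↔ i = 0 ∨ i = p.length) ∧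
      p.getVert i ≠ x := fun i hi => by
    by_cases h0 : i = 0
    · subst h0; simpa using ⟨hs.symm, hs.ne'⟩
    by_cases h1 : i = p.length
    · subst h1; simpa using ⟨ht.symm, ht.ne'⟩
    rcases hp _ (p.getVert_mem_support i) with h | h | h
    · exact absurd (h.symm.trans rfl) (by simpa using hinj 0 i (by omega) hi)
    · exact absurd h (by simpa using hinj i p.length (by omega) le_rfl)
    · exact ⟨⟨fun h' => absurd h'.symm h.2, by omega⟩, h.1⟩
  refine not_isEmpty_iff.2 ?_ (isChordal_iff_isEmpty_embedding.1 hG (p.length + 2) (by omega))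
  refine nonempty_cycleGraph_embedding (fun i => if i ≤ p.length then p.getVert i else x) ?_ ?_
  · intro i j hij hj
    rw [if_pos (by omega : i ≤ p.length)]
    split_ifs with h
    · exact hinj i j hij h
    · exact (hx i (by omega)).2
  · intro i j hij hj
    rw [if_pos (by omega : i ≤ p.length)]
    split_ifs with h
    · refine ⟨fun h' => Or.inl (hcons i j hij h h'), ?_⟩
      rintro (rfl | ⟨-, h'⟩)
      · exact p.adj_getVert_succ (by omega)
      · omega
    · rw [(hx i (by omega)).1]
      omega

/-- D is the component of y in W after removing x and its neighbours, and T consists of the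
neighbours of x in W bordering D. Two elements of T are joined by a walk through D, so `adj_of_walk`
applies. -/
theorem IsChordal.exists_clique_separator (hG : G.IsChordal) {W : Set V} {x y : V} (hy : y ∈ W)
    (hyx : y ≠ x) (hxy : ¬ G.Adj x y) :
    ∃ D T : Set V, y ∈ D ∧ D ⊆ W ∧ (∀ d ∈ D, d ≠ x ∧ ¬ G.Adj x d) ∧ T ⊆ W ∧
      (∀ t ∈ T, G.Adj x t) ∧ G.IsClique T ∧ ∀ d ∈ D, ∀ u ∈ W, G.Adj d u → u ∈ D ∪ T := by
  let D : Set V := {d | ∃ p : G.Walk y d, ∀ v ∈ p.support, v ∈ W ∧ v ≠ x ∧ ¬ G.Adj x v}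
  refine ⟨D, {t | t ∈ W ∧ G.Adj x t ∧ ∃ d ∈ D, G.Adj d t}, ⟨Walk.nil, by simp [*]⟩, ?_, ?_,
    fun t ht => ht.1, fun t ht => ht.2.1, ?_, ?_⟩
  · rintro d ⟨p, hp⟩
    exact (hp d p.end_mem_support).1
  · rintro d ⟨p, hp⟩
    exact (hp d p.end_mem_support).2
  · rintro s ⟨-, hs, d, ⟨p, hp⟩, hd⟩ t ⟨-, ht, e, ⟨q, hq⟩, he⟩ hst
    refine hG.adj_of_walk hs ht hst (Walk.cons hd.symm (p.reverse.append (q.concat he))) ?_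
    intro v hv
    simp only [Walk.support_cons, List.mem_cons, Walk.mem_support_append_iff,
      Walk.support_reverse, List.mem_reverse, Walk.support_concat, List.mem_append, List.not_mem_nil, or_false] at hv
    rcases hv with h | h | h | h
    · exact Or.inl h
    · exact Or.inr (Or.inr (hp v h).2)
    · exact Or.inr (Or.inr (hq v h).2)
    · exact Or.inr (Or.inl h)
  · rintro d ⟨p, hp⟩ u hu hdu
    by_cases hxu : G.Adj x u
    · exact Or.inr ⟨hu, hxu, d, ⟨p, hp⟩, hdu⟩
    · refine Or.inl ⟨p.concat hdu, fun v hv => ?_⟩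
      rw [Walk.support_concat, List.mem_append, List.mem_singleton] at hv
      rcases hv with hv | rfl
      · exact hp v hv
      · refine ⟨hu, ?_, hxu⟩
        rintro rfl
        exact (hp d p.end_mem_support).2.2 hdu.symm

/-- Asking for a simplicial vertex away from a prescribed x makes the induction work. Neighbours in
W of a vertex of D lie in D ∪ T, which misses x, so a vertex of D simplicial in D ∪ T suffices. -/
theorem IsChordal.exists_simplicial (hG : G.IsChordal) (W : Finset V) {x y : V} (hx : x ∈ W)
    (hy : y ∈ W) (hyx : y ≠ x) (hxy : ¬ G.Adj x y) :
    ∃ v ∈ W, v ≠ x ∧ ¬ G.Adj x v ∧ G.IsClique {a | a ∈ W ∧ G.Adj v a} := by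
  classical
  induction W using Finset.strongInduction generalizing x y with
  | H W ih =>
  obtain ⟨D, T, hyD, hDW, hDx, hTW, hTx, hT, hDT⟩ :=
    hG.exists_clique_separator (W := (W : Set V)) hy hyx hxy
  suffices h : ∃ v ∈ D, G.IsClique {a : V | (a ∈ D ∨ a ∈ T) ∧ G.Adj v a} by
    obtain ⟨v, hv, hcl⟩ := h
    exact ⟨v, hDW hv, (hDx v hv).1, (hDx v hv).2,
      fun a ha b hb => hcl ⟨hDT v hv a ha.1 ha.2, ha.2⟩ ⟨hDT v hv b hb.1 hb.2, hb.2⟩⟩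
  let U := W.filter fun a => a ∈ D ∨ a ∈ T
  have memU : ∀ a, a ∈ U ↔ a ∈ D ∨ a ∈ T := fun a => by
    simp only [U, Finset.mem_filter, and_iff_right_iff_imp]
    exact fun h => h.elim (fun h => hDW h) (fun h => hTW h)
  have hUW : U ⊂ W := by
    refine Finset.filter_ssubset.2 ⟨x, hx, ?_⟩
    rintro (h | h)
    · exact (hDx x h).1 rfl
    · exact (hTx x h).ne rfl
  -- The induction hypothesis at t yields a vertex not adjacent to t, hence outside the clique T. If
  -- every t is joined to all of U, the same holds with a vertex of D in the role of t; if that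
  -- fails too, U is a clique and y works.
  by_cases h1 : ∃ t ∈ T, ∃ z ∈ U, z ≠ t ∧ ¬ G.Adj t z
  · obtain ⟨t, ht, z, hz, hzt, htz⟩ := h1
    obtain ⟨v, hv, hvt, htv, hcl⟩ := ih U hUW ((memU t).2 (Or.inr ht)) hz hzt htz
    simp only [memU] at hcl hv
    exact ⟨v, hv.resolve_right fun h => htv (hT ht h hvt.symm), hcl⟩
  push Not at h1
  by_cases h2 : ∃ d ∈ D, ∃ z ∈ U, z ≠ d ∧ ¬ G.Adj d z
  · obtain ⟨d, hd, z, hz, hzd, hdz⟩ := h2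
    obtain ⟨v, hv, hvd, hdv, hcl⟩ := ih U hUW ((memU d).2 (Or.inl hd)) hz hzd hdz
    simp only [memU] at hcl hv
    exact ⟨v, hv.resolve_right fun h =>
      hdv (h1 v h d ((memU d).2 (Or.inl hd)) hvd.symm).symm, hcl⟩
  · push Not at h2
    refine ⟨y, hyD, fun a ha b hb hab => ?_⟩
    rcases ha.1 with h | h
    · exact h2 a h b ((memU b).2 hb.1) hab.symm
    · exact h1 a h b ((memU b).2 hb.1) hab.symm

theorem IsChordal.exists_isCliqueDecomposition (hG : G.IsChordal) (h : G ≠ ⊤) :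
    ∃ A B : Set V, G.IsCliqueDecomposition A B := by
  obtain ⟨x, y, hxy, hne⟩ := ne_top_iff_exists_not_adj.1 h
  obtain ⟨D, T, hyD, -, hDx, -, hTx, hT, hDT⟩ :=
    hG.exists_clique_separator (Set.mem_univ y) hxy.symm hne
  refine ⟨D ∪ T, Dᶜ, ?_, ?_, ?_, ?_, hT.subset ?_⟩
  · intro h
    rcases (h ▸ Set.mem_univ x : x ∈ D ∪ T) with h | h
    · exact (hDx x h).1 rfl
    · exact (hTx x h).ne rfl
  · intro h
    exact (h ▸ Set.mem_univ y : y ∈ Dᶜ) hyD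
  · ext v
    by_cases hv : v ∈ D <;> simp [hv]
  · intro u v huv
    by_cases hu : u ∈ D
    · exact Or.inl ⟨Or.inl hu, hDT u hu v trivial huv⟩
    by_cases hv : v ∈ D
    · exact Or.inl ⟨hDT v hv u trivial huv.symm, Or.inl hv⟩
    · exact Or.inr ⟨hu, hv⟩
  · rintro v ⟨h | h, hv⟩
    · exact absurd h hv
    · exact h

/-! ### Proper subgraphs and cliques of a cycle -/

/-- The vertex f i has two distinct neighbours f (i ± 1) in H, and only two in the big cycle, so f i
+ 1 is one of them. The image is therefore closed under adding 1, and every edge of the big cycle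
lies in H. -/
theorem cycleGraph_le_of_hom {m n : ℕ} (H : SimpleGraph (Fin (n + 3)))
    (hH : H ≤ cycleGraph (n + 3)) (f : cycleGraph (m + 3) →g H) (hf : Function.Injective f) :
    cycleGraph (n + 3) ≤ H := by
  have h2 : (1 + 1 : Fin (m + 3)) ≠ 0 := fun h => by
    have := congrArg Fin.val h
    rw [Fin.val_add, Fin.val_one, Fin.val_zero, Nat.mod_eq_of_lt (by omega)] at this
    omega
  have key : ∀ i, ∃ j, f j = f i + 1 ∧ H.Adj (f i) (f i + 1) := fun i => by
    have a1 : H.Adj (f i) (f (i + 1)) := f.map_adj (by simp [cycleGraph_adj])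
    have a2 : H.Adj (f i) (f (i - 1)) := f.map_adj (by simp [cycleGraph_adj])
    have hne : f (i + 1) ≠ f (i - 1) := fun h => by
      have := hf h
      rw [eq_sub_iff_add_eq, add_assoc, add_eq_left] at this
      exact h2 this
    rcases cycleGraph_adj.1 (hH a1) with h | h
    · rcases cycleGraph_adj.1 (hH a2) with h' | h'
      · exact absurd (sub_right_inj.1 (h.trans h'.symm)) hne
      · have e : f (i - 1) = f i + 1 := sub_eq_iff_eq_add'.1 h'
        exact ⟨_, e, e ▸ a2⟩
    · have e : f (i + 1) = f i + 1 := sub_eq_iff_eq_add'.1 h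
      exact ⟨_, e, e ▸ a1⟩
  have surj : ∀ u, ∃ i, f i = u := fun u => by
    have : ∀ k : Fin (n + 3), ∃ i, f i = f 0 + k := fun k => by
      induction k using Fin.induction with
      | zero => exact ⟨0, by simp⟩
      | succ k ih =>
        obtain ⟨i, hi⟩ := ih
        obtain ⟨j, hj, -⟩ := key i
        exact ⟨j, by rw [hj, hi, add_assoc, Fin.coeSucc_eq_succ]⟩
    obtain ⟨i, hi⟩ := this (u - f 0)
    exact ⟨i, by rw [hi, add_sub_cancel]⟩
  have succ_adj : ∀ u, H.Adj u (u + 1) := fun u => by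
    obtain ⟨i, rfl⟩ := surj u
    exact (key i).choose_spec.2
  intro u v huv
  rcases cycleGraph_adj.1 huv with h | h
  · have := succ_adj v
    rw [← sub_eq_iff_eq_add'.1 h] at this
    exact this.symm
  · have := succ_adj u
    rwa [← sub_eq_iff_eq_add'.1 h] at this

theorem isChordal_of_lt_cycleGraph {n : ℕ} (hn : 3 < n) {H : SimpleGraph (Fin n)}
    (hH : H < cycleGraph n) : H.IsChordal := by
  refine isChordal_iff_isEmpty_embedding.2 fun m hm => ⟨fun f => hH.not_ge ?_⟩
  obtain ⟨n, rfl⟩ : ∃ k, n = k + 3 := ⟨n - 3, by omega⟩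
  obtain ⟨m, rfl⟩ : ∃ k, m = k + 3 := ⟨m - 3, by omega⟩
  exact cycleGraph_le_of_hom H hH.le f.toHom f.injective

theorem hasDimension_cliqueComplex_cycleGraph {n : ℕ} (hn : 3 < n) :
    HasDimension (cycleGraph n).cliqueComplex 1 := by
  refine ⟨⟨{⟨0, by omega⟩, ⟨1, by omega⟩}, ?_, ?_⟩, ?_⟩
  · have : (cycleGraph n).Adj ⟨0, by omega⟩ ⟨1, by omega⟩ :=
      (cycleGraph_adj_iff_of_lt (by simp [Fin.lt_def])).2 (Or.inl rfl)
    simpa [cliqueComplex, isClique_pair] using this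
  · rw [Finset.card_pair (by simp)]
    norm_num
  · rintro k ⟨F, hF, rfl⟩
    by_contra! h
    obtain ⟨T, hTF, hT⟩ := Finset.exists_subset_card_eq (by omega : 3 ≤ F.card)
    have key : ∀ a ∈ T, ∀ b ∈ T, a < b → (b : ℕ) = a + 1 ∨ ((a : ℕ) = 0 ∧ (b : ℕ) + 1 = n) :=
      fun a ha b hb hab => (cycleGraph_adj_iff_of_lt hab).1 (hF (hTF ha) (hTF hb) hab.ne)
    let e := T.orderEmbOfFin hT
    have h01 := key (e 0) (by simp [e]) (e 1) (by simp [e]) (by simp)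
    have h12 := key (e 1) (by simp [e]) (e 2) (by simp [e]) (by simp)
    have h02 := key (e 0) (by simp [e]) (e 2) (by simp [e]) (by simp)
    omega

end SimpleGraph

/-! ### Homogeneous solutions of homogeneous linear systems -/

namespace MvPolynomial

variable {σ R : Type*} [CommRing R]

theorem homogeneousComponent_mul {p : MvPolynomial σ R} {e : ℕ} (hp : p.IsHomogeneous e)
    (n : ℕ) (q : MvPolynomial σ R) :
    homogeneousComponent n (p * q) = if e ≤ n then p * homogeneousComponent (n - e) q else 0 := by
  conv_lhs => rw [← q.sum_homogeneousComponent, Finset.mul_sum, map_sum]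
  have key : ∀ i, homogeneousComponent n (p * homogeneousComponent i q) =
      if n = e + i then p * homogeneousComponent i q else 0 := fun i =>
    homogeneousComponent_of_mem (hp.mul (homogeneousComponent_isHomogeneous i q))
  simp_rw [key]
  split_ifs with h
  · obtain ⟨m, rfl⟩ := Nat.exists_eq_add_of_le h
    simp only [add_right_inj, Finset.sum_ite_eq, Finset.mem_range, Nat.add_sub_cancel_left]
    split_ifs with h'
    · rfl
    · rw [homogeneousComponent_eq_zero _ _ (by omega), mul_zero]
  · exact Finset.sum_eq_zero fun i _ => if_neg (by omega)

variable {A B : Type*}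

/-- A vector over the polynomial ring, homogeneous of degree `n` when the `b`-th basis vector
has degree `deg b`. -/
def IsHomogeneousVec (deg : B → ℕ) (n : ℕ) (u : B → MvPolynomial σ R) : Prop :=
  ∀ b a, coeff a (u b) ≠ 0 → a.degree + deg b = n

/-- The part of degree `n` of a vector over the polynomial ring, the `b`-th basis vector having
degree `deg b`. -/
noncomputable def vecComponent (deg : B → ℕ) (n : ℕ) (u : B → MvPolynomial σ R) : B → MvPolynomial σ R :=
  fun b => if deg b ≤ n then homogeneousComponent (n - deg b) (u b) else 0

theorem coeff_vecComponent (deg : B → ℕ) (n : ℕ) (u : B → MvPolynomial σ R) (b : B)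
    (a : σ →₀ ℕ) :
    coeff a (vecComponent deg n u b) = if a.degree + deg b = n then coeff a (u b) else 0 := by
  rw [vecComponent]
  split_ifs with h1 h2 h2
  · rw [coeff_homogeneousComponent, if_pos (by omega)]
  · rw [coeff_homogeneousComponent, if_neg (by omega)]
  · omega
  · simp

theorem isHomogeneousVec_vecComponent (deg : B → ℕ) (n : ℕ) (u : B → MvPolynomial σ R) :
    IsHomogeneousVec deg n (vecComponent deg n u) := by
  intro b a h
  rw [coeff_vecComponent] at h
  by_contra h'
  exact h (if_neg h')

theorem IsHomogeneousVec.vecComponent_eq {deg : B → ℕ} {n : ℕ} {u : B → MvPolynomial σ R}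
    (hu : IsHomogeneousVec deg n u) : vecComponent deg n u = u := by
  ext b a
  rw [coeff_vecComponent, ite_eq_left_iff]
  intro h
  by_contra h'
  exact h (hu b a (Ne.symm h'))

theorem mulVec_vecComponent [Fintype B] {M : Matrix A B (MvPolynomial σ R)} {degA : A → ℕ}
    {degB : B → ℕ}
    (hM : ∀ a b, M a b ≠ 0 → ∃ e, degA a + e = degB b ∧ (M a b).IsHomogeneous e)
    (n : ℕ) (p : B → MvPolynomial σ R) :
    M.mulVec (vecComponent degB n p) = vecComponent degA n (M.mulVec p) := by
  ext1 a
  have key : ∀ b, M a b * vecComponent degB n p b =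
      if degA a ≤ n then homogeneousComponent (n - degA a) (M a b * p b) else 0 := fun b => by
    by_cases h0 : M a b = 0
    · simp [h0]
    obtain ⟨e, he, hhom⟩ := hM a b h0
    rw [homogeneousComponent_mul hhom, vecComponent]
    split_ifs with h1 h2 h3 h2 h3
    · rw [show n - degA a - e = n - degB b by omega]
    · omega
    · omega
    · omega
    · exact mul_zero _
    · exact mul_zero _
  simp only [Matrix.mulVec, dotProduct, vecComponent] at key ⊢
  simp_rw [key]
  split_ifs
  · rw [map_sum]
  · simp

theorem exists_isHomogeneousVec_mulVec_eq [Fintype B] {M : Matrix A B (MvPolynomial σ R)}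
    {degA : A → ℕ} {degB : B → ℕ}
    (hM : ∀ a b, M a b ≠ 0 → ∃ e, degA a + e = degB b ∧ (M a b).IsHomogeneous e)
    {n : ℕ} {u : A → MvPolynomial σ R} (hu : IsHomogeneousVec degA n u)
    {p : B → MvPolynomial σ R} (hp : M.mulVec p = u) :
    ∃ q, IsHomogeneousVec degB n q ∧ M.mulVec q = u :=
  ⟨_, isHomogeneousVec_vecComponent degB n p, by
    rw [mulVec_vecComponent hM, hp, hu.vecComponent_eq]⟩

/-- Each column is solved separately, and only the degree k part of the solution is kept. -/
theorem exists_isHomogeneous_mul_eq [Fintype B] {C : Type*} {e k : ℕ}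
    {M : Matrix A B (MvPolynomial σ R)} (hM : ∀ a b, (M a b).IsHomogeneous e)
    {N : Matrix A C (MvPolynomial σ R)} (hN : ∀ a c, (N a c).IsHomogeneous (e + k))
    (h : ∀ c, ∃ p, M.mulVec p = fun a => N a c) :
    ∃ L : Matrix B C (MvPolynomial σ R), (∀ b c, (L b c).IsHomogeneous k) ∧ M * L = N := by
  choose p hp using h
  refine ⟨Matrix.of fun b c => homogeneousComponent k (p c b),
    fun b c => homogeneousComponent_isHomogeneous _ _, ?_⟩
  ext1 a c
  have := congrArg (homogeneousComponent (e + k)) (congrFun (hp c) a)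
  rw [homogeneousComponent_eq_self (hN a c)] at this
  rw [← this, Matrix.mul_apply, Matrix.mulVec, dotProduct, map_sum]
  exact Finset.sum_congr rfl fun b _ => by
    rw [homogeneousComponent_mul (hM a b), if_pos (by omega), Nat.add_sub_cancel_left]
    rfl

end MvPolynomial

/-! ### Linear resolutions and comparison maps -/

/-- A `d`-linear free resolution of an ideal, over arbitrary finite bases: the generators have
degree `d`, and the entries of the differentials are linear forms. -/
structure LinearResolution {σ K : Type*} [Field K] (I : Ideal (MvPolynomial σ K)) (d : ℕ) where
  B : ℕ → Type
  fintypeB : ∀ i, Fintype (B i)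
  gen : B 0 → MvPolynomial σ K
  diff : ∀ i, Matrix (B i) (B (i + 1)) (MvPolynomial σ K)
  gen_isHomogeneous : ∀ b, (gen b).IsHomogeneous d
  diff_isHomogeneous : ∀ i a b, (diff i a b).IsHomogeneous 1
  span_gen : Ideal.span (Set.range gen) = I
  exact_zero : ∀ p, p ⬝ᵥ gen = 0 ↔ ∃ q, (diff 0).mulVec q = p
  exact_succ : ∀ i p, (diff i).mulVec p = 0 ↔ ∃ q, (diff (i + 1)).mulVec q = p

namespace LinearResolution

variable {σ K : Type*} [Field K] {I J P : Ideal (MvPolynomial σ K)} {d : ℕ}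

attribute [instance] fintypeB

theorem mem_iff (F : LinearResolution I d) {f : MvPolynomial σ K} :
    f ∈ I ↔ ∃ p, p ⬝ᵥ F.gen = f := by
  conv_lhs => rw [← F.span_gen]
  exact Ideal.mem_span_range_iff_exists_fun

theorem gen_dotProduct_diff (F : LinearResolution I d) (q : F.B 1 → MvPolynomial σ K) :
    (F.diff 0).mulVec q ⬝ᵥ F.gen = 0 :=
  (F.exact_zero _).2 ⟨q, rfl⟩

theorem diff_mulVec_diff (F : LinearResolution I d) (i : ℕ) (q : F.B (i + 2) → MvPolynomial σ K) :
    (F.diff i).mulVec ((F.diff (i + 1)).mulVec q) = 0 :=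
  (F.exact_succ i _).2 ⟨q, rfl⟩

/-- A linear resolution, its bases enumerated, is a minimal graded free resolution. -/
noncomputable def toMinimal (F : LinearResolution I d) : MinimalGradedFreeResolution I where
  rank i := Fintype.card (F.B i)
  deg i _ := d + i
  gen := F.gen ∘ (Fintype.equivFin _).symm
  diff i := (F.diff i).submatrix (Fintype.equivFin _).symm (Fintype.equivFin _).symm
  gen_isHomogeneous _ := F.gen_isHomogeneous _
  diff_isHomogeneous i _ _ _ := ⟨1, rfl, F.diff_isHomogeneous i _ _⟩
  span_gen := by rw [EquivLike.range_comp, F.span_gen]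
  exact_zero := by
    intro p
    have h1 : Fintype.linearCombination (MvPolynomial σ K)
        (F.gen ∘ (Fintype.equivFin _).symm) p = (p ∘ Fintype.equivFin _) ⬝ᵥ F.gen := by
      rw [Fintype.linearCombination_apply, dotProduct]
      exact Fintype.sum_equiv (Fintype.equivFin _).symm _ _ fun b => by simp
    rw [h1, F.exact_zero]
    constructor
    · rintro ⟨q, hq⟩
      refine ⟨q ∘ (Fintype.equivFin _).symm, ?_⟩
      rw [Matrix.mulVecLin_apply, Matrix.submatrix_mulVec_equiv, Function.comp_assoc]
      simp [hq, Function.comp_assoc]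
    · rintro ⟨q, rfl⟩
      refine ⟨q ∘ Fintype.equivFin _, ?_⟩
      rw [Matrix.mulVecLin_apply, Matrix.submatrix_mulVec_equiv, Function.comp_assoc]
      simp
  exact_succ := by
    intro i p
    rw [Matrix.mulVecLin_apply, Matrix.submatrix_mulVec_equiv]
    have h1 : ((F.diff i).mulVec (p ∘ (Fintype.equivFin (F.B (i + 1))).symm.symm)) ∘
        (Fintype.equivFin (F.B i)).symm = 0 ↔
        (F.diff i).mulVec (p ∘ Fintype.equivFin (F.B (i + 1))) = 0 := by
      refine ⟨fun h => ?_, fun h => ?_⟩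
      · ext1 b
        simpa using congrFun h (Fintype.equivFin _ b)
      · rw [Equiv.symm_symm, h]
        rfl
    rw [h1, F.exact_succ]
    constructor
    · rintro ⟨q, hq⟩
      refine ⟨q ∘ (Fintype.equivFin _).symm, ?_⟩
      rw [Matrix.mulVecLin_apply, Matrix.submatrix_mulVec_equiv, Function.comp_assoc]
      simp [hq, Function.comp_assoc]
    · rintro ⟨q, rfl⟩
      refine ⟨q ∘ Fintype.equivFin _, ?_⟩
      rw [Matrix.mulVecLin_apply, Matrix.submatrix_mulVec_equiv, Function.comp_assoc]
      simp
  minimal i a b := by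
    by_contra h
    have := F.diff_isHomogeneous i _ _ h
    simp at this

theorem hasRegularity (F : LinearResolution I d) (hI : I ≠ ⊥) : HasRegularity I d := by
  -- Without a generator all Betti numbers could vanish, and the empty set has no supremum in ℤ.
  have hB : Nonempty (F.B 0) := by
    by_contra h
    rw [not_nonempty_iff] at h
    exact hI (by rw [← F.span_gen, Set.range_eq_empty, Ideal.span_empty])
  refine ⟨F.toMinimal, ?_⟩
  suffices h : {m : ℤ | ∃ i j : ℕ, F.toMinimal.betti i j ≠ 0 ∧ m = (j : ℤ) - (i : ℤ)} = {(d : ℤ)} by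
    rw [h]
    exact isLUB_singleton
  ext m
  simp only [Set.mem_ofPred_eq, Set.mem_singleton_iff]
  constructor
  · rintro ⟨i, j, h, rfl⟩
    obtain ⟨b, hb⟩ := Finset.card_ne_zero.1 h
    have : d + i = j := (Finset.mem_filter.1 hb).2
    omega
  · rintro rfl
    refine ⟨0, d, Finset.card_ne_zero.2 ⟨Fintype.equivFin _ hB.some, ?_⟩, by simp⟩
    exact Finset.mem_filter.2 ⟨Finset.mem_univ _, rfl⟩

/-- The zero ideal has linear resolutions, with all bases empty. -/
noncomputable def bot (σ K : Type*) [Field K] (d : ℕ) : LinearResolution (⊥ : Ideal (MvPolynomial σ K)) d where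
  B _ := Empty
  fintypeB _ := inferInstance
  gen := Empty.elim
  diff _ := Matrix.of fun a => a.elim
  gen_isHomogeneous b := b.elim
  diff_isHomogeneous _ b := b.elim
  span_gen := by rw [Set.range_eq_empty, Ideal.span_empty]
  exact_zero p := ⟨fun _ => ⟨p, Subsingleton.elim _ _⟩, fun _ => by simp⟩
  exact_succ _ p := ⟨fun _ => ⟨p, Subsingleton.elim _ _⟩, fun _ => Subsingleton.elim _ _⟩

/-- The unit ideal has a `0`-linear resolution, of length zero. -/
noncomputable def top (σ K : Type*) [Field K] : LinearResolution (⊤ : Ideal (MvPolynomial σ K)) 0 where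
  B i := match i with
    | 0 => Unit
    | _ + 1 => Empty
  fintypeB i := match i with
    | 0 => inferInstanceAs (Fintype Unit)
    | _ + 1 => inferInstanceAs (Fintype Empty)
  gen _ := 1
  diff _ := Matrix.of fun _ b => b.elim
  gen_isHomogeneous _ := isHomogeneous_one _ _
  diff_isHomogeneous _ _ b := b.elim
  span_gen := by
    rw [Ideal.eq_top_iff_one]
    exact Ideal.subset_span ⟨(), rfl⟩
  exact_zero p := by
    refine ⟨fun h => ⟨Empty.elim, ?_⟩, ?_⟩
    · ext1 b
      have : p b = 0 := by simpa [dotProduct] using h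
      rw [this]
      simp only [Matrix.mulVec, dotProduct]
      exact (Finset.sum_eq_zero fun j _ => Empty.elim j)
    · rintro ⟨q, rfl⟩
      simp [Matrix.mulVec, dotProduct]
  exact_succ _ p := by
    refine ⟨fun _ => ⟨Empty.elim, ?_⟩, fun _ => ?_⟩
    · ext1 b
      exact b.elim
    · ext1 b
      simp only [Matrix.mulVec, dotProduct]
      exact (Finset.sum_eq_zero fun j _ => Empty.elim j)

/-- The comparison theorem for the inclusion of J in P. The entries are linear because the
generators of J lie one degree above those of P. -/
theorem exists_lift (F : LinearResolution J (d + 1)) (E : LinearResolution P d) (h : J ≤ P) :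
    ∃ φ : ∀ i, Matrix (E.B i) (F.B i) (MvPolynomial σ K),
      (∀ i a b, (φ i a b).IsHomogeneous 1) ∧
      (∀ q, (φ 0).mulVec q ⬝ᵥ E.gen = q ⬝ᵥ F.gen) ∧
      ∀ i, E.diff i * φ (i + 1) = φ i * F.diff i := by
  -- The invariant of the recursion: the columns of φ ∘ ∂ are boundaries of E, so the next matrix
  -- exists.
  let Q : ∀ i, Matrix (E.B i) (F.B i) (MvPolynomial σ K) → Prop := fun i φ =>
    (∀ a b, (φ a b).IsHomogeneous 1) ∧
      ∀ b, ∃ p, (E.diff i).mulVec p = fun a => (φ * F.diff i) a b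
  obtain ⟨φ₀, hφ₀, hgen⟩ : ∃ φ₀, Q 0 φ₀ ∧ ∀ q, φ₀.mulVec q ⬝ᵥ E.gen = q ⬝ᵥ F.gen := by
    obtain ⟨φ, hφ, hφ'⟩ := exists_isHomogeneous_mul_eq (k := 1)
      (M := Matrix.of fun (_ : Unit) b => E.gen b) (N := Matrix.of fun (_ : Unit) b => F.gen b)
      (fun _ => E.gen_isHomogeneous) (fun _ => F.gen_isHomogeneous) fun c => by
        classical
        obtain ⟨p, hp⟩ := E.mem_iff.1 (h (F.mem_iff.2 ⟨Pi.single c 1, rfl⟩))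
        refine ⟨p, funext fun _ => ?_⟩
        simpa [dotProduct_comm, Matrix.mulVec] using hp
    have hgen : ∀ q, φ.mulVec q ⬝ᵥ E.gen = q ⬝ᵥ F.gen := fun q => by
      have := congrFun (congrArg (fun M => Matrix.mulVec M q) hφ') ()
      simp only [← Matrix.mulVec_mulVec] at this
      rw [dotProduct_comm, dotProduct_comm q]
      exact this
    refine ⟨φ, ⟨hφ, fun b => (E.exact_zero _).1 ?_⟩, hgen⟩
    classical
    have := hgen ((F.diff 0).mulVec (Pi.single b 1))
    rw [F.gen_dotProduct_diff, Matrix.mulVec_mulVec, Matrix.mulVec_single_one] at this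
    exact this
  have step : ∀ i (φ : {φ // Q i φ}), ∃ ψ : {ψ // Q (i + 1) ψ},
      E.diff i * ψ.1 = φ.1 * F.diff i := by
    rintro i ⟨φ, hφ, hφ'⟩
    obtain ⟨ψ, hψ, hψ'⟩ := exists_isHomogeneous_mul_eq (e := 1) (k := 1)
      (E.diff_isHomogeneous i) (N := φ * F.diff i) (fun a c => by
        rw [Matrix.mul_apply]
        exact IsHomogeneous.sum _ _ _ fun b _ => (hφ a b).mul (F.diff_isHomogeneous i b c)) hφ'
    refine ⟨⟨ψ, hψ, fun b => (E.exact_succ _ _).1 ?_⟩, hψ'⟩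
    classical
    have : (E.diff i).mulVec ((ψ * F.diff (i + 1)).mulVec (Pi.single b 1)) = 0 := by
      rw [Matrix.mulVec_mulVec, ← Matrix.mul_assoc, hψ', Matrix.mul_assoc,
        ← Matrix.mulVec_mulVec, ← Matrix.mulVec_mulVec, F.diff_mulVec_diff, Matrix.mulVec_zero]
    rwa [Matrix.mulVec_single_one] at this
  choose next hnext using step
  let φ : ∀ i, {φ // Q i φ} := fun i => Nat.rec ⟨φ₀, hφ₀⟩ next i
  exact ⟨fun i => (φ i).1, fun i => (φ i).2.1, hgen, fun i => hnext i (φ i)⟩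

end LinearResolution

/-! ### The mapping cone -/

namespace LinearResolution

variable {σ K : Type*} [Field K] {J P : Ideal (MvPolynomial σ K)} {d : ℕ}

/-- The bases of a complex, shifted by one step. -/
abbrev shiftB (B : ℕ → Type) : ℕ → Type
  | 0 => Empty
  | i + 1 => B i

instance (B : ℕ → Type) [∀ i, Fintype (B i)] : ∀ i, Fintype (shiftB B i)
  | 0 => inferInstanceAs (Fintype Empty)
  | i + 1 => inferInstanceAs (Fintype (B i))

/-- The differentials of a complex, shifted by one step. -/
def shiftDiff {R : Type*} {B : ℕ → Type} (D : ∀ i, Matrix (B i) (B (i + 1)) R) :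
    ∀ i, Matrix (shiftB B i) (B i) R
  | 0 => Matrix.of fun a => a.elim
  | i + 1 => D i

open Classical in
/-- The differential of the mapping cone of `(x, -φ) : F → F ⊕ E`. -/
noncomputable def coneDiff (F : LinearResolution J (d + 1)) (E : LinearResolution P d)
    (x : MvPolynomial σ K) (φ : ∀ i, Matrix (E.B i) (F.B i) (MvPolynomial σ K)) (i : ℕ) :
    Matrix ((F.B i ⊕ E.B i) ⊕ shiftB F.B i) ((F.B (i + 1) ⊕ E.B (i + 1)) ⊕ F.B i)
      (MvPolynomial σ K) :=
  Matrix.fromBlocks (Matrix.fromBlocks (F.diff i) 0 0 (E.diff i))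
    (Matrix.fromRows (Matrix.diagonal fun _ => x) (-φ i)) 0 (-shiftDiff F.diff i)

theorem coneDiff_mulVec (F : LinearResolution J (d + 1)) (E : LinearResolution P d)
    (x : MvPolynomial σ K) (φ : ∀ i, Matrix (E.B i) (F.B i) (MvPolynomial σ K)) (i : ℕ)
    (a : F.B (i + 1) → MvPolynomial σ K) (b : E.B (i + 1) → MvPolynomial σ K)
    (c : F.B i → MvPolynomial σ K) :
    (coneDiff F E x φ i).mulVec (Sum.elim (Sum.elim a b) c) =
      Sum.elim (Sum.elim ((F.diff i).mulVec a + x • c) ((E.diff i).mulVec b - (φ i).mulVec c))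
        (-(shiftDiff F.diff i).mulVec c) := by
  classical
  ext1 ((k | k) | k) <;>
    simp [coneDiff, Matrix.fromBlocks_mulVec, Matrix.fromRows_mulVec,
      Matrix.neg_mulVec, sub_eq_add_neg]

/-- If `x` is a linear form which is a nonzerodivisor modulo `J ⊆ P`, then linear resolutions of
`J` and `P` give one of `J + x P`, through the exact sequence `0 → J → J ⊕ P → J + x P → 0`. -/
theorem nonempty_sup_span_mul (F : LinearResolution J (d + 1)) (E : LinearResolution P d)
    (hJP : J ≤ P) {x : MvPolynomial σ K} (hx : x.IsHomogeneous 1) (hx0 : x ≠ 0)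
    (hxJ : ∀ p, x * p ∈ J → p ∈ J) :
    Nonempty (LinearResolution (J ⊔ Ideal.span {x} * P) (d + 1)) := by
  obtain ⟨φ, hφ, hφ0, hφs⟩ := exists_lift F E hJP
  have hφs' : ∀ i q, (E.diff i).mulVec ((φ (i + 1)).mulVec q) =
      (φ i).mulVec ((F.diff i).mulVec q) := fun i q => by
    rw [Matrix.mulVec_mulVec, Matrix.mulVec_mulVec, hφs]
  have split : ∀ {A B C : Type} (q : (A ⊕ B) ⊕ C → MvPolynomial σ K),
      ∃ a b c, q = Sum.elim (Sum.elim a b) c := fun q =>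
    ⟨_, _, _, by rw [Sum.elim_comp_inl_inr, Sum.elim_comp_inl_inr]⟩
  have gen_iff : ∀ a b (c : Empty → MvPolynomial σ K), (Sum.elim (Sum.elim a b) c) ⬝ᵥ
      (Sum.elim (Sum.elim F.gen (x • E.gen)) Empty.elim) =
      a ⬝ᵥ F.gen + x * (b ⬝ᵥ E.gen) := fun a b c => by
    simp [sumElim_dotProduct_sumElim, dotProduct_smul]
  have shift_zero : ∀ i (q : F.B (i + 1) → MvPolynomial σ K),
      (shiftDiff F.diff i).mulVec ((F.diff i).mulVec q) = 0 := fun i q => by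
    cases i with
    | zero => exact funext fun k => k.elim
    | succ i => exact F.diff_mulVec_diff i q
  refine ⟨{
    B := fun i => (F.B i ⊕ E.B i) ⊕ shiftB F.B i
    fintypeB := fun i => inferInstance
    gen := Sum.elim (Sum.elim F.gen (x • E.gen)) Empty.elim
    diff := coneDiff F E x φ
    gen_isHomogeneous := ?_
    diff_isHomogeneous := ?_
    span_gen := ?_
    exact_zero := ?_
    exact_succ := ?_ }⟩
  · rintro ((k | k) | k)
    · exact F.gen_isHomogeneous k
    · have := hx.mul (E.gen_isHomogeneous k)
      rwa [add_comm] at this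
    · exact k.elim
  · classical
    have h0 : ∀ n, (0 : MvPolynomial σ K).IsHomogeneous n := isHomogeneous_zero σ K
    rintro i ((k | k) | k) ((l | l) | l)
    · exact F.diff_isHomogeneous i k l
    · exact h0 1
    · change ((Matrix.diagonal fun _ => x : Matrix (F.B i) (F.B i) _) k l).IsHomogeneous 1
      rw [Matrix.diagonal_apply]
      split_ifs
      · exact hx
      · exact h0 1
    · exact h0 1
    · exact E.diff_isHomogeneous i k l
    · exact (hφ i k l).neg
    · exact h0 1
    · exact h0 1
    · cases i with
      | zero => exact k.elim
      | succ i => exact (F.diff_isHomogeneous i k l).neg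
  · ext f
    rw [Ideal.mem_span_range_iff_exists_fun, Submodule.mem_sup]
    constructor
    · rintro ⟨c, rfl⟩
      obtain ⟨a, b, c, rfl⟩ := split c
      exact ⟨_, F.mem_iff.2 ⟨a, rfl⟩, _,
        Ideal.mul_mem_mul (Ideal.mem_span_singleton_self x) (E.mem_iff.2 ⟨b, rfl⟩),
        (gen_iff a b c).symm⟩
    · rintro ⟨f, hf, g, hg, rfl⟩
      obtain ⟨a, rfl⟩ := F.mem_iff.1 hf
      obtain ⟨g, hg', rfl⟩ := Ideal.mem_span_singleton_mul.1 hg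
      obtain ⟨b, rfl⟩ := E.mem_iff.1 hg'
      exact ⟨_, gen_iff a b Empty.elim⟩
  · intro p
    obtain ⟨a, b, c, rfl⟩ := split p
    rw [gen_iff]
    constructor
    · intro h
      -- A relation f + x g = 0 with f in J forces g into J; a lift of g to F, negated, is the
      -- shifted component of the preimage.
      have hb : b ⬝ᵥ E.gen ∈ J := hxJ _ <| by
        rw [← neg_eq_of_add_eq_zero_right h]
        exact J.neg_mem (F.mem_iff.2 ⟨a, rfl⟩)
      obtain ⟨q, hq⟩ := F.mem_iff.1 hb
      obtain ⟨a', ha'⟩ := (F.exact_zero (a + x • q)).1 (by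
        rw [add_dotProduct, smul_dotProduct, hq, smul_eq_mul, h])
      obtain ⟨b', hb'⟩ := (E.exact_zero (b - (φ 0).mulVec q)).1 (by
        rw [sub_dotProduct, hφ0, hq, sub_self])
      refine ⟨Sum.elim (Sum.elim a' b') (-q), ?_⟩
      rw [coneDiff_mulVec, ha', hb', Matrix.mulVec_neg, smul_neg, add_neg_cancel_right,
        sub_neg_eq_add, sub_add_cancel]
      congr 1
      exact funext fun k => k.elim
    · rintro ⟨q, hq⟩
      obtain ⟨a', b', c', rfl⟩ := split q
      rw [coneDiff_mulVec] at hq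
      have ha : a = _ := (congrArg (fun f => (f ∘ Sum.inl) ∘ Sum.inl) hq).symm
      have hb : b = _ := (congrArg (fun f => (f ∘ Sum.inl) ∘ Sum.inr) hq).symm
      simp only [Sum.elim_comp_inl, Sum.elim_comp_inr] at ha hb
      rw [ha, hb, add_dotProduct, sub_dotProduct, F.gen_dotProduct_diff, E.gen_dotProduct_diff,
        hφ0, smul_dotProduct, smul_eq_mul]
      ring
  · intro i p
    obtain ⟨a, b, c, rfl⟩ := split p
    constructor
    · intro h
      rw [coneDiff_mulVec] at h
      have ha := congrArg (fun f => (f ∘ Sum.inl) ∘ Sum.inl) h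
      have hb := congrArg (fun f => (f ∘ Sum.inl) ∘ Sum.inr) h
      have hc := congrArg (fun f => f ∘ Sum.inr) h
      simp only [Sum.elim_comp_inl, Sum.elim_comp_inr] at ha hb hc
      replace ha : (F.diff i).mulVec a + x • c = 0 := ha
      replace hb : (E.diff i).mulVec b - (φ i).mulVec c = 0 := hb
      replace hc : (shiftDiff F.diff i).mulVec c = 0 := neg_eq_zero.1 hc
      -- For i = 0 the shifted differential is empty and `hc` says nothing. Applying the generators
      -- to `ha` instead gives x times the image of c equal to zero, and x ≠ 0.
      obtain ⟨c', rfl⟩ : ∃ q, (F.diff i).mulVec q = c := by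
        cases i with
        | zero =>
          rw [← F.exact_zero]
          have := congrArg (· ⬝ᵥ F.gen) ha
          simp only [add_dotProduct, F.gen_dotProduct_diff, smul_dotProduct, zero_dotProduct,
            zero_add, smul_eq_mul] at this
          exact (mul_eq_zero.1 this).resolve_left hx0
        | succ i => exact (F.exact_succ i c).1 hc
      obtain ⟨a', ha'⟩ := (F.exact_succ i (a + x • c')).1 (by
        rw [Matrix.mulVec_add, Matrix.mulVec_smul, ha])
      obtain ⟨b', hb'⟩ := (E.exact_succ i (b - (φ (i + 1)).mulVec c')).1 (by
        rw [Matrix.mulVec_sub, hφs', hb])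
      refine ⟨Sum.elim (Sum.elim a' b') (-c'), ?_⟩
      rw [coneDiff_mulVec, ha', hb', Matrix.mulVec_neg, Matrix.mulVec_neg, smul_neg,
        add_neg_cancel_right, sub_neg_eq_add, sub_add_cancel, neg_neg]
      rfl
    · rintro ⟨q, hq⟩
      obtain ⟨a', b', c', rfl⟩ := split q
      rw [← hq, coneDiff_mulVec, coneDiff_mulVec]
      change Sum.elim (Sum.elim (_ + x • -(F.diff i).mulVec c')
        (_ - (φ i).mulVec (-(F.diff i).mulVec c')))
        (-(shiftDiff F.diff i).mulVec (-(F.diff i).mulVec c')) = 0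
      simp only [Matrix.mulVec_add, Matrix.mulVec_sub, Matrix.mulVec_neg, shift_zero,
        F.diff_mulVec_diff, E.diff_mulVec_diff, hφs', Matrix.mulVec_smul]
      ext1 ((k | k) | k) <;> simp

end LinearResolution

/-! ### Monomial ideals -/

namespace MvPolynomial

variable {σ K : Type*} [Field K]

variable (K) in
/-- The ideal generated by the monomials with exponents in a given set. -/
noncomputable def monomialIdeal (S : Set (σ →₀ ℕ)) : Ideal (MvPolynomial σ K) :=
  Ideal.span ((fun s => monomial s 1) '' S)

theorem mem_monomialIdeal {S : Set (σ →₀ ℕ)} {p : MvPolynomial σ K} :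
    p ∈ monomialIdeal K S ↔ ∀ a, coeff a p ≠ 0 → ∃ s ∈ S, s ≤ a := by
  simp [monomialIdeal, mem_ideal_span_monomial_image]

theorem monomialIdeal_union (S T : Set (σ →₀ ℕ)) :
    monomialIdeal K (S ∪ T) = monomialIdeal K S ⊔ monomialIdeal K T := by
  rw [monomialIdeal, Set.image_union, Ideal.span_union, monomialIdeal, monomialIdeal]

theorem span_X_mul_monomialIdeal (v : σ) (S : Set (σ →₀ ℕ)) :
    Ideal.span {X v} * monomialIdeal K S =
      monomialIdeal K ((fun s => Finsupp.single v 1 + s) '' S) := by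
  rw [monomialIdeal, Ideal.span_mul_span', Set.singleton_mul, Set.image_image, monomialIdeal,
    Set.image_image]
  simp [X, monomial_mul]

/-- Supplies the nonzerodivisor hypothesis of the cone: x_v plays no part in divisibility by
generators that avoid it. -/
theorem mem_monomialIdeal_of_X_mul_mem {S : Set (σ →₀ ℕ)} {v : σ} (hS : ∀ s ∈ S, s v = 0)
    {p : MvPolynomial σ K} (hp : X v * p ∈ monomialIdeal K S) : p ∈ monomialIdeal K S := by
  classical
  rw [mem_monomialIdeal] at hp ⊢
  intro a ha
  obtain ⟨s, hs, hsa⟩ := hp (Finsupp.single v 1 + a) (by rwa [coeff_X_mul])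
  refine ⟨s, hs, fun u => ?_⟩
  have := hsa u
  rw [Finsupp.add_apply, Finsupp.single_apply] at this
  split_ifs at this with h
  · subst h
    rw [hS s hs]
    exact Nat.zero_le _
  · simpa using this

/-- An ideal generated by variables has a `1`-linear resolution. -/
theorem nonempty_linearResolution_variables (N : Finset σ) :
    Nonempty (LinearResolution (monomialIdeal K ((fun u => Finsupp.single u 1) '' (N : Set σ)))
      1) := by
  classical
  induction N using Finset.induction with
  | empty =>
    have : monomialIdeal K ((fun u => Finsupp.single u 1) '' ((∅ : Finset σ) : Set σ)) = ⊥ := by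
      simp [monomialIdeal]
    rw [this]
    exact ⟨LinearResolution.bot σ K 1⟩
  | insert u N hu ih =>
    obtain ⟨F⟩ := ih
    have := LinearResolution.nonempty_sup_span_mul F (LinearResolution.top σ K) le_top
      (isHomogeneous_X K u) (X_ne_zero u) (fun p => mem_monomialIdeal_of_X_mul_mem (by
        rintro _ ⟨w, hw, rfl⟩
        exact Finsupp.single_eq_of_ne (by rintro rfl; exact hu hw)))
    convert this using 2
    rw [Finset.coe_insert, Set.insert_eq, Set.image_union, Set.union_comm, monomialIdeal_union,
      Ideal.mul_top]
    simp [monomialIdeal, X]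

end MvPolynomial

/-! ### Chordal graphs have linear resolutions -/

namespace SimpleGraph

variable {V K : Type*} [Field K] {G : SimpleGraph V}

/-- The exponents of the monomials `x_u x_v` over the pairs of distinct non-adjacent vertices
`u`, `v` in `W`. -/
def nonedgeExponents (G : SimpleGraph V) (W : Set V) : Set (V →₀ ℕ) :=
  {s | ∃ u ∈ W, ∃ v ∈ W, Gᶜ.Adj u v ∧ s = Finsupp.single u 1 + Finsupp.single v 1}

theorem circuitIdeal_eq_monomialIdeal :
    G.circuitIdeal K = monomialIdeal K (G.nonedgeExponents Set.univ) := by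
  rw [circuitIdeal, edgeIdeal, monomialIdeal]
  congr 1
  ext f
  simp [nonedgeExponents, X, monomial_mul, eq_comm]

theorem mem_circuitIdeal {p : MvPolynomial V K} :
    p ∈ G.circuitIdeal K ↔ ∀ a, coeff a p ≠ 0 → ∃ u v, Gᶜ.Adj u v ∧
      Finsupp.single u 1 + Finsupp.single v 1 ≤ a := by
  rw [circuitIdeal_eq_monomialIdeal, mem_monomialIdeal]
  simp [nonedgeExponents]

/-- Sorting non-edges by whether they contain v puts the ideal in the form J + x_v P required by the
cone. -/
theorem nonedgeExponents_eq_union (W : Set V) {v : V} (hv : v ∈ W) :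
    G.nonedgeExponents W = G.nonedgeExponents (W \ {v}) ∪
      (fun s => Finsupp.single v 1 + s) '' ((fun u => Finsupp.single u 1) ''
        {u | u ∈ W ∧ Gᶜ.Adj v u}) := by
  ext s
  constructor
  · rintro ⟨a, ha, b, hb, hab, rfl⟩
    by_cases h1 : a = v
    · subst h1
      exact Or.inr ⟨_, ⟨b, ⟨hb, hab⟩, rfl⟩, rfl⟩
    by_cases h2 : b = v
    · subst h2
      exact Or.inr ⟨_, ⟨a, ⟨ha, hab.symm⟩, rfl⟩, add_comm _ _⟩
    · exact Or.inl ⟨a, ⟨ha, h1⟩, b, ⟨hb, h2⟩, hab, rfl⟩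
  · rintro (⟨a, ha, b, hb, hab, rfl⟩ | ⟨_, ⟨u, ⟨hu, hvu⟩, rfl⟩, rfl⟩)
    · exact ⟨a, ha.1, b, hb.1, hab, rfl⟩
    · exact ⟨v, hv, u, hu, hvu, rfl⟩

theorem IsChordal.exists_simplicial_of_nonempty (hG : G.IsChordal) {W : Finset V}
    (hW : W.Nonempty) : ∃ v ∈ W, G.IsClique {a | a ∈ W ∧ G.Adj v a} := by
  by_cases h : G.IsClique (W : Set V)
  · obtain ⟨v, hv⟩ := hW
    exact ⟨v, hv, fun a ha b hb => h ha.1 hb.1⟩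
  · simp only [IsClique, Set.Pairwise] at h
    push Not at h
    obtain ⟨x, hx, y, hy, hxy, hne⟩ := h
    obtain ⟨v, hv, -, -, hcl⟩ := hG.exists_simplicial W hx hy hxy.symm hne
    exact ⟨v, hv, hcl⟩

theorem IsChordal.nonempty_linearResolution (hG : G.IsChordal) (W : Finset V) :
    Nonempty (LinearResolution (monomialIdeal K (G.nonedgeExponents (W : Set V))) 2) := by
  classical
  induction W using Finset.strongInduction with
  | H W ih =>
  rcases W.eq_empty_or_nonempty with rfl | hW
  · have : monomialIdeal K (G.nonedgeExponents ((∅ : Finset V) : Set V)) = ⊥ := by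
      simp [monomialIdeal, nonedgeExponents]
    rw [this]
    exact ⟨LinearResolution.bot V K 2⟩
  obtain ⟨v, hv, hcl⟩ := hG.exists_simplicial_of_nonempty hW
  obtain ⟨F⟩ := ih (W.erase v) (Finset.erase_ssubset hv)
  obtain ⟨E⟩ := nonempty_linearResolution_variables (K := K) (W.filter fun u => Gᶜ.Adj v u)
  rw [Finset.coe_erase] at F
  rw [Finset.coe_filter] at E
  rw [nonedgeExponents_eq_union _ hv, monomialIdeal_union, ← span_X_mul_monomialIdeal]
  refine F.nonempty_sup_span_mul E ?_ (isHomogeneous_X K v) (X_ne_zero v)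
    fun p => mem_monomialIdeal_of_X_mul_mem ?_
  · intro p hp
    rw [mem_monomialIdeal] at hp ⊢
    intro a ha
    obtain ⟨_, ⟨u, hu, w, hw, huw, rfl⟩, hle⟩ := hp a ha
    -- This is J ≤ P: the neighbours of v form a clique, so a non-edge uw has an end not adjacent to
    -- v.
    by_cases h : G.Adj v u
    · refine ⟨_, ⟨w, ⟨hw.1, Ne.symm hw.2, fun h' => huw.2 ?_⟩, rfl⟩, le_add_self.trans hle⟩
      exact hcl ⟨hu.1, h⟩ ⟨hw.1, h'⟩ huw.1
    · exact ⟨_, ⟨u, ⟨hu.1, Ne.symm hu.2, h⟩, rfl⟩, le_self_add.trans hle⟩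
  · rintro _ ⟨u, hu, w, hw, -, rfl⟩
    rw [Finsupp.add_apply, Finsupp.single_eq_of_ne (Ne.symm hu.2),
      Finsupp.single_eq_of_ne (Ne.symm hw.2), add_zero]

theorem circuitIdeal_top : (⊤ : SimpleGraph V).circuitIdeal K = ⊥ := by
  simp [circuitIdeal, edgeIdeal]

theorem X_mul_X_mem_circuitIdeal {u v : V} (h : Gᶜ.Adj u v) :
    X u * X v ∈ G.circuitIdeal K :=
  Ideal.subset_span ⟨u, v, h, rfl⟩

theorem hasInitialDegree_circuitIdeal (h : G ≠ ⊤) : HasInitialDegree (G.circuitIdeal K) 2 := by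
  obtain ⟨x, y, hxy, hne⟩ := ne_top_iff_exists_not_adj.1 h
  refine ⟨⟨X x * X y, X_mul_X_mem_circuitIdeal ⟨hxy, hne⟩,
    mul_ne_zero (X_ne_zero x) (X_ne_zero y), (isHomogeneous_X K x).mul (isHomogeneous_X K y)⟩, ?_⟩
  rintro k ⟨f, hf, hf0, hk⟩
  obtain ⟨a, ha⟩ := exists_coeff_ne_zero hf0
  obtain ⟨u, v, -, hle⟩ := mem_circuitIdeal.1 hf a ha
  have h2 := Finsupp.degree_mono hle
  have h3 : a.degree = k := by
    by_contra h'
    exact ha (hk.coeff_eq_zero h')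
  simpa [h3, map_add] using h2

theorem IsChordal.hasLinearResolution [Finite V] (hG : G.IsChordal) (h : G ≠ ⊤) :
    HasLinearResolution (G.circuitIdeal K) 2 := by
  cases nonempty_fintype V
  refine ⟨?_, hasInitialDegree_circuitIdeal h⟩
  obtain ⟨F⟩ := hG.nonempty_linearResolution (K := K) Finset.univ
  rw [Finset.coe_univ, ← circuitIdeal_eq_monomialIdeal] at F
  refine F.hasRegularity fun h' => ?_
  obtain ⟨f, hf, hf0, -⟩ := (hasInitialDegree_circuitIdeal (K := K) h).1
  rw [h'] at hf
  exact hf0 hf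

end SimpleGraph

/-! ### The Koszul complex and its exactness -/

namespace Koszul

variable {V K : Type*} [Field K] [LinearOrder V]

/-- The number of elements of `τ` below `v`, which governs the signs of the Koszul complex. -/
def pos (v : V) (τ : Finset V) : ℕ := (τ.filter (· < v)).card

theorem pos_insert {u v : V} {τ : Finset V} (hv : v ∉ τ) :
    pos u (insert v τ) = pos u τ + if v < u then 1 else 0 := by
  rw [pos, pos, Finset.filter_insert]
  split_ifs
  · rw [Finset.card_insert_of_notMem fun h => hv (Finset.mem_filter.1 h).1]
  · rfl

variable (K) in
/-- The entries `± x_v` of the differentials of the Koszul complex. -/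
noncomputable def entry (v : V) (τ : Finset V) : MvPolynomial V K := (-1) ^ pos v τ * X v

theorem entry_mul_entry {u v : V} {τ : Finset V} (huv : u ≠ v) (hu : u ∉ τ) (hv : v ∉ τ) :
    entry K v τ * entry K u (insert v τ) + entry K u τ * entry K v (insert u τ) = 0 := by
  rw [entry, entry, entry, entry, pos_insert hv, pos_insert hu]
  rcases lt_or_gt_of_ne huv with h | h
  · rw [if_pos h, if_neg h.not_gt]
    ring
  · rw [if_pos h, if_neg h.not_gt]
    ring

theorem coeff_entry_mul (v : V) (τ : Finset V) (a : V →₀ ℕ) (p : MvPolynomial V K) :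
    coeff a (entry K v τ * p) =
      if a v ≠ 0 then (-1) ^ pos v τ * coeff (a - Finsupp.single v 1) p else 0 := by
  have : entry K v τ * p = C ((-1) ^ pos v τ) * (X v * p) := by simp [entry, mul_assoc]
  rw [this, coeff_C_mul, coeff_X_mul']
  simp only [Finsupp.mem_support_iff]
  split_ifs <;> simp

variable [Fintype V]

section Module

variable {M N : Type*} [AddCommGroup M] [Module (MvPolynomial V K) M]
  [AddCommGroup N] [Module (MvPolynomial V K) N]

variable (K) in
/-- The differential of the Koszul complex of the variables, with coefficients in a module; the
value at `τ` is the coefficient of the basis vector `e_τ`. -/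
noncomputable def d (f : Finset V → M) (τ : Finset V) : M :=
  ∑ v ∈ τᶜ, entry K v τ • f (insert v τ)

theorem d_d (f : Finset V → M) (τ : Finset V) : d K (d K f) τ = 0 := by
  simp only [d, Finset.smul_sum, smul_smul]
  rw [Finset.sum_sigma']
  -- Inserting the two vertices in the opposite order changes the sign.
  refine Finset.sum_involution (fun x _ => ⟨x.2, x.1⟩) ?_ ?_ ?_ ?_
  · rintro ⟨v, u⟩ h
    simp only [Finset.mem_sigma, Finset.mem_compl, Finset.mem_insert, not_or] at h ⊢
    rw [Finset.insert_comm, ← add_smul, entry_mul_entry h.2.1 h.2.2 h.1, zero_smul]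
  · rintro ⟨v, u⟩ h - he
    simp only [Finset.mem_sigma, Finset.mem_compl, Finset.mem_insert, not_or] at h
    exact h.2.1 (congrArg Sigma.fst he)
  · rintro ⟨v, u⟩ h
    simp only [Finset.mem_sigma, Finset.mem_compl, Finset.mem_insert, not_or] at h ⊢
    exact ⟨h.2.2, Ne.symm h.2.1, h.1⟩
  · rintro ⟨v, u⟩ -
    rfl

theorem map_d (L : M →ₗ[MvPolynomial V K] N) (f : Finset V → M) (τ : Finset V) :
    L (d K f τ) = d K (fun τ => L (f τ)) τ := by
  simp only [d, map_sum, map_smul]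

theorem d_sub (f g : Finset V → M) (τ : Finset V) :
    d K (fun τ => f τ - g τ) τ = d K f τ - d K g τ := by
  simp only [d, smul_sub, Finset.sum_sub_distrib]

end Module

theorem coeff_d (f : Finset V → MvPolynomial V K) (τ : Finset V) (a : V →₀ ℕ) :
    coeff a (d K f τ) = ∑ v ∈ τᶜ, if a v ≠ 0 then
      (-1) ^ pos v τ * coeff (a - Finsupp.single v 1) (f (insert v τ)) else 0 := by
  simp only [d, coeff_sum, smul_eq_mul, coeff_entry_mul]

/-- Divide by `x_v`, keeping only monomials in which the least variable is `x_v` before the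
division. -/
noncomputable def leastDiv (v : V) (p : MvPolynomial V K) : MvPolynomial V K :=
  ∑ a ∈ (p.divMonomial (Finsupp.single v 1)).support.filter fun a => ∀ u < v, a u = 0,
    monomial a (coeff (Finsupp.single v 1 + a) p)

theorem coeff_leastDiv (v : V) (p : MvPolynomial V K) (a : V →₀ ℕ) :
    coeff a (leastDiv v p) =
      if ∀ u < v, a u = 0 then coeff (Finsupp.single v 1 + a) p else 0 := by
  have hmem : a ∈ (p.divMonomial (Finsupp.single v 1)).support.filter (fun a => ∀ u < v, a u = 0) ↔
      coeff (Finsupp.single v 1 + a) p ≠ 0 ∧ ∀ u < v, a u = 0 := by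
    rw [Finset.mem_filter, mem_support_iff, coeff_divMonomial]
  simp only [leastDiv, coeff_sum, coeff_monomial, Finset.sum_ite_eq']
  by_cases h : ∀ u < v, a u = 0
  · rw [if_pos h, ite_eq_left_iff]
    intro h'
    by_contra h0
    exact h' (hmem.2 ⟨Ne.symm h0, h⟩)
  · rw [if_neg h, if_neg fun h' => h (hmem.1 h').2]

/-- The contracting homotopy of the Koszul complex: in each multidegree, wedge with `e_v` and
divide by `x_v`, where `v` is the least element of the support of the multidegree. -/
noncomputable def homotopy (f : Finset V → MvPolynomial V K) (τ : Finset V) : MvPolynomial V K :=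
  ∑ v ∈ τ.filter fun v => ∀ u ∈ τ, v ≤ u, leastDiv v (f (τ.erase v))

theorem coeff_homotopy_of_mem (f : Finset V → MvPolynomial V K) {τ : Finset V} {a : V →₀ ℕ}
    {v : V} (hv : v ∈ τ) (hτ : ∀ u ∈ τ, v ≤ u) (ha : ∀ u, a u ≠ 0 → v ≤ u) :
    coeff a (homotopy f τ) = coeff (Finsupp.single v 1 + a) (f (τ.erase v)) := by
  have : τ.filter (fun v => ∀ u ∈ τ, v ≤ u) = {v} := by
    ext w
    simp only [Finset.mem_filter, Finset.mem_singleton]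
    exact ⟨fun h => le_antisymm (h.2 v hv) (hτ w h.1), by rintro rfl; exact ⟨hv, hτ⟩⟩
  rw [homotopy, this, Finset.sum_singleton, coeff_leastDiv, if_pos]
  intro u hu
  by_contra h
  exact (ha u h).not_gt hu

theorem coeff_homotopy_of_notMem (f : Finset V → MvPolynomial V K) {τ : Finset V} {a : V →₀ ℕ}
    {v : V} (hv : v ∉ τ) (hτ : ∀ u ∈ τ, v ≤ u) (ha : a v ≠ 0) :
    coeff a (homotopy f τ) = 0 := by
  rw [homotopy, coeff_sum]
  refine Finset.sum_eq_zero fun w hw => ?_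
  have hw := (Finset.mem_filter.1 hw).1
  rw [coeff_leastDiv, if_neg]
  exact fun h => ha (h v (lt_of_le_of_ne (hτ w hw) (by rintro rfl; exact hv hw)))

/-- The Koszul complex of the variables is a resolution of the residue field. -/
theorem d_homotopy {f : Finset V → MvPolynomial V K} (hf : ∀ τ, d K f τ = 0)
    (h0 : constantCoeff (f ∅) = 0) : d K (homotopy f) = f := by
  ext τ a
  -- Only multidegree zero has no least vertex; there both sides vanish, by `h0`.
  by_cases hne : ∃ v, v ∈ τ ∨ a v ≠ 0
  swap
  · push Not at hne
    obtain rfl : τ = ∅ := Finset.eq_empty_of_forall_notMem fun v => (hne v).1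
    obtain rfl : a = 0 := Finsupp.ext fun v => (hne v).2
    rw [coeff_d]
    simpa [constantCoeff_eq] using h0.symm
  obtain ⟨v, hv, hmin⟩ : ∃ v, (v ∈ τ ∨ a v ≠ 0) ∧ ∀ u, (u ∈ τ ∨ a u ≠ 0) → v ≤ u := by
    obtain ⟨v, hv⟩ := hne
    obtain ⟨w, hw, hw'⟩ := (τ ∪ a.support).exists_minimal
      ⟨v, by simpa [Finset.mem_union] using hv⟩
    simp only [Finset.mem_union, Finsupp.mem_support_iff] at hw hw'
    exact ⟨w, hw, fun u hu => (le_total w u).elim id (hw' hu)⟩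
  have hτ : ∀ u ∈ τ, v ≤ u := fun u hu => hmin u (Or.inl hu)
  have ha : ∀ u, a u ≠ 0 → v ≤ u := fun u hu => hmin u (Or.inr hu)
  have hsub : ∀ u w : V, (a - Finsupp.single u 1 : V →₀ ℕ) w ≠ 0 → a w ≠ 0 := fun u w h h' => by
    rw [Finsupp.tsub_apply, h', zero_tsub] at h
    exact h rfl
  -- If v ∈ τ, the cycle condition at `τ.erase v` expresses the coefficient of f at τ through the
  -- other terms. Inserting v below u flips the sign of each of them.
  by_cases hvτ : v ∈ τ
  · have key := congrArg (coeff (Finsupp.single v 1 + a)) (hf (τ.erase v))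
    rw [coeff_d, Finset.compl_erase, Finset.sum_insert (by simpa using hvτ), coeff_zero,
      Finset.insert_erase hvτ, if_pos (by simp), add_tsub_cancel_left] at key
    have hpos : pos v (τ.erase v) = 0 := by
      rw [pos, Finset.card_eq_zero, Finset.filter_eq_empty_iff]
      exact fun u hu => (hτ u (Finset.mem_of_mem_erase hu)).not_gt
    rw [hpos, pow_zero, one_mul] at key
    rw [coeff_d, eq_neg_of_add_eq_zero_left key, ← Finset.sum_neg_distrib]
    refine Finset.sum_congr rfl fun u hu => ?_
    rw [Finset.mem_compl] at hu
    have huv : u ≠ v := by rintro rfl; exact hu hvτ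
    rw [Finsupp.add_apply, Finsupp.single_eq_of_ne huv, zero_add]
    split_ifs with hau
    · rw [coeff_homotopy_of_mem f (v := v) (Finset.mem_insert_of_mem hvτ) ?_
        fun w hw => ha w (hsub _ _ hw)]
      · conv_lhs => rw [← Finset.insert_erase hvτ, pos_insert (Finset.notMem_erase v τ),
          if_pos (lt_of_le_of_ne (ha u hau) huv.symm), Finset.insert_erase hvτ]
        rw [Finset.erase_insert_of_ne huv, add_tsub_assoc_of_le, pow_succ]
        · ring
        · rwa [Finsupp.single_le_iff, Nat.one_le_iff_ne_zero]
      · intro w hw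
        rcases Finset.mem_insert.1 hw with rfl | hw
        · exact ha w hau
        · exact hτ w hw
    · rw [neg_zero]
  -- If v ∉ τ, only the summand that inserts v survives.
  · have hav : a v ≠ 0 := hv.resolve_left hvτ
    rw [coeff_d, Finset.sum_eq_single_of_mem v (by simpa using hvτ)]
    · have hpos : pos v τ = 0 := by
        rw [pos, Finset.card_eq_zero, Finset.filter_eq_empty_iff]
        exact fun u hu => (hτ u hu).not_gt
      rw [if_pos hav, hpos, pow_zero, one_mul,
        coeff_homotopy_of_mem f (Finset.mem_insert_self v τ) ?_ fun w hw => ha w (hsub _ _ hw),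
        Finset.erase_insert hvτ, add_tsub_cancel_of_le]
      · rwa [Finsupp.single_le_iff, Nat.one_le_iff_ne_zero]
      · intro w hw
        rcases Finset.mem_insert.1 hw with rfl | hw
        · exact le_rfl
        · exact hτ w hw
    · intro u hu huv
      rw [Finset.mem_compl] at hu
      split_ifs with hau
      · rw [coeff_homotopy_of_notMem f (v := v), mul_zero]
        · simpa [huv.symm] using hvτ
        · intro w hw
          rcases Finset.mem_insert.1 hw with rfl | hw
          · exact ha w hau
          · exact hτ w hw
        · rwa [Finsupp.tsub_apply, Finsupp.single_eq_of_ne huv.symm, tsub_zero]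
      · rfl

theorem exists_d_eq_of_vec {B : Type*} {f : Finset V → B → MvPolynomial V K}
    (hf : ∀ τ, d K f τ = 0) (h0 : ∀ b, constantCoeff (f ∅ b) = 0) :
    ∃ y : Finset V → B → MvPolynomial V K, ∀ τ, d K y τ = f τ := by
  have happ : ∀ (g : Finset V → B → MvPolynomial V K) (τ : Finset V) (b : B),
      d K g τ b = d K (fun τ => g τ b) τ := fun g τ b => map_d (LinearMap.proj b) g τ
  refine ⟨fun τ b => homotopy (fun τ => f τ b) τ, fun τ => ?_⟩
  ext1 b
  rw [happ]
  exact congrFun (d_homotopy (fun τ => by rw [← happ, hf]; rfl) (h0 b)) τ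

end Koszul

/-! ### From degree bounds on a resolution to Koszul boundaries -/

namespace Koszul

variable {V K : Type*} [Field K]

/-- An element of the Koszul complex with coefficients in a free module with basis in degrees
`deg`, homogeneous of degree `n`. -/
def IsHomogeneousChain {B : Type*} (deg : B → ℕ) (n : ℕ) (f : Finset V → B → MvPolynomial V K) :
    Prop :=
  ∀ τ b a, coeff a (f τ b) ≠ 0 → a.degree + deg b + τ.card = n

theorem IsHomogeneousChain.d [LinearOrder V] [Fintype V] {B : Type*} {deg : B → ℕ} {n : ℕ}
    {f : Finset V → B → MvPolynomial V K} (hf : IsHomogeneousChain deg n f) :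
    IsHomogeneousChain deg n (d K f) := by
  intro τ b a h
  have : Koszul.d K f τ b = Koszul.d K (fun τ => f τ b) τ :=
    map_d (LinearMap.proj (R := MvPolynomial V K) b) f τ
  rw [this, coeff_d] at h
  obtain ⟨v, hv, hne⟩ := Finset.exists_ne_zero_of_sum_ne_zero h
  split_ifs at hne with hav
  · have := hf _ _ _ (right_ne_zero_of_mul hne)
    rw [Finset.card_insert_of_notMem (Finset.mem_compl.1 hv)] at this
    have h2 : (a - Finsupp.single v 1 + Finsupp.single v 1 : V →₀ ℕ) = a :=
      tsub_add_cancel_of_le (by rwa [Finsupp.single_le_iff, Nat.one_le_iff_ne_zero])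
    have h3 := congrArg Finsupp.degree h2
    rw [map_add, Finsupp.degree_single] at h3
    omega
  · exact absurd rfl hne

theorem card_eq_of_d_ne_zero [LinearOrder V] [Fintype V] {M : Type*} [AddCommGroup M] [Module (MvPolynomial V K) M] {k : ℕ}
    {f : Finset V → M} (hf : ∀ τ, f τ ≠ 0 → τ.card = k + 1) {τ : Finset V} (h : d K f τ ≠ 0) :
    τ.card = k := by
  obtain ⟨v, hv, hne⟩ := Finset.exists_ne_zero_of_sum_ne_zero h
  have := hf _ (right_ne_zero_of_smul hne)
  rw [Finset.card_insert_of_notMem (Finset.mem_compl.1 hv)] at this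
  omega

/-- Lift a homogeneous chain through a homogeneous matrix. -/
theorem exists_lift {A B : Type*} [Fintype A] [Fintype B] {M : Matrix A B (MvPolynomial V K)}
    {degA : A → ℕ} {degB : B → ℕ}
    (hM : ∀ a b, M a b ≠ 0 → ∃ e, degA a + e = degB b ∧ (M a b).IsHomogeneous e)
    {n : ℕ} {u : Finset V → A → MvPolynomial V K} (hu : IsHomogeneousChain degA n u)
    (h : ∀ τ, ∃ p, M.mulVec p = u τ) :
    ∃ w : Finset V → B → MvPolynomial V K, IsHomogeneousChain degB n w ∧
      (∀ τ, M.mulVec (w τ) = u τ) ∧ ∀ τ, w τ ≠ 0 → u τ ≠ 0 := by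
  have key : ∀ τ, ∃ q, (∀ b a, coeff a (q b) ≠ 0 → a.degree + degB b + τ.card = n) ∧
      M.mulVec q = u τ ∧ (q ≠ 0 → u τ ≠ 0) := fun τ => by
    -- Zero is lifted to zero, so that lifting keeps the homological degree.
    by_cases h0 : u τ = 0
    · exact ⟨0, by simp, by simp [h0], by simp⟩
    have hle : τ.card ≤ n := by
      obtain ⟨b, hb⟩ := Function.ne_iff.1 h0
      obtain ⟨a, ha⟩ := exists_coeff_ne_zero hb
      have := hu τ b a ha
      omega
    obtain ⟨p, hp⟩ := h τ
    obtain ⟨q, hq, hq'⟩ := exists_isHomogeneousVec_mulVec_eq hM (n := n - τ.card) (u := u τ)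
      (fun b a ha => by have := hu τ b a ha; omega) hp
    exact ⟨q, fun b a ha => by have := hq b a ha; omega, hq', fun _ => h0⟩
  choose w h1 h2 h3 using key
  exact ⟨w, h1, h2, h3⟩

/-- If the generators of a minimal free resolution of `I` in step `i` have degree at most `i + r`,
then every Koszul cycle modulo `I` of homological degree `m` and internal degree `n ≥ m + r` is a
boundary modulo `I`. -/
theorem exists_sub_d_mem [LinearOrder V] [Fintype V] {I : Ideal (MvPolynomial V K)} (F : MinimalGradedFreeResolution I)
    {m n r : ℕ} (hF : ∀ i b, F.deg i b ≤ i + r) (hmn : m + r ≤ n) (hm : 0 < m)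
    (hI : ∀ f ∈ I, constantCoeff f = 0) {z : Finset V → MvPolynomial V K}
    (hz : ∀ τ, z τ ≠ 0 → τ.card = m)
    (hzn : ∀ τ a, coeff a (z τ) ≠ 0 → a.degree + τ.card = n) (hdz : ∀ τ, d K z τ ∈ I) :
    ∃ t : Finset V → MvPolynomial V K, ∀ τ, z τ - d K t τ ∈ I := by
  obtain ⟨m, rfl⟩ : ∃ k, m = k + 1 := ⟨m - 1, by omega⟩
  let ε := Fintype.linearCombination (MvPolynomial V K) F.gen
  have hε : ∀ p, ε p ∈ I := fun p => by
    have : ε p ∈ Ideal.span (Set.range F.gen) := by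
      rw [Ideal.mem_span_range_iff_exists_fun]
      exact ⟨p, by simp [ε, Fintype.linearCombination_apply]⟩
    rwa [F.span_gen] at this
  -- The zigzag: w_k has Koszul degree m - k and coefficients in F_k, and its Koszul differential
  -- lifts to w_{k+1}.
  let Q : ∀ k, (Finset V → Fin (F.rank k) → MvPolynomial V K) → Prop := fun k w =>
    (∀ τ, w τ ≠ 0 → τ.card + k = m) ∧ IsHomogeneousChain (F.deg k) n w ∧
      ∀ τ, ∃ p, (F.diff k).mulVec p = d K w τ
  obtain ⟨w₀, hw₀, hεw⟩ : ∃ w, Q 0 w ∧ ∀ τ, ε (w τ) = d K z τ := by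
    have hchain : IsHomogeneousChain (fun _ : Unit => 0) n (d K fun τ (_ : Unit) => z τ) :=
      IsHomogeneousChain.d fun τ _ a ha => hzn τ a ha
    have hd : ∀ τ, d K (fun τ (_ : Unit) => z τ) τ = fun _ => d K z τ := fun τ => by
      ext1 b
      exact map_d (LinearMap.proj (R := MvPolynomial V K) b) (fun τ (_ : Unit) => z τ) τ
    have hmul : ∀ p, (Matrix.of fun (_ : Unit) b => F.gen b).mulVec p = fun _ => ε p := fun p => by
      ext1 b
      simp [ε, Fintype.linearCombination_apply, Matrix.mulVec, dotProduct, mul_comm]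
    obtain ⟨w, hw, hw', hw0⟩ := exists_lift (degB := F.deg 0)
      (M := Matrix.of fun (_ : Unit) b => F.gen b)
      (fun _ b _ => ⟨_, zero_add _, F.gen_isHomogeneous b⟩) hchain fun τ => by
        have := hdz τ
        rw [← F.span_gen, Ideal.mem_span_range_iff_exists_fun] at this
        obtain ⟨p, hp⟩ := this
        refine ⟨p, ?_⟩
        rw [hmul, hd]
        ext1 b
        simpa [ε, Fintype.linearCombination_apply] using hp
    have hεw : ∀ τ, ε (w τ) = d K z τ := fun τ => by
      have := hw' τ
      rw [hmul, hd] at this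
      exact congrFun this ()
    refine ⟨w, ⟨fun τ h => ?_, hw, fun τ => ?_⟩, hεw⟩
    · refine card_eq_of_d_ne_zero (K := K) hz fun h' => hw0 τ h ?_
      rw [hd, h']
      rfl
    · refine (F.exact_zero _).1 ?_
      rw [map_d]
      simp only [ε] at hεw
      rw [funext hεw]
      exact d_d z τ
  have step : ∀ k (w : {w // Q k w}), ∃ w' : {w // Q (k + 1) w},
      ∀ τ, (F.diff k).mulVec (w'.1 τ) = d K w.1 τ := by
    rintro k ⟨w, hcard, hw, hr⟩
    obtain ⟨w', hw', hlift, h0⟩ := exists_lift (F.diff_isHomogeneous k) hw.d hr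
    refine ⟨⟨w', fun τ h => ?_, hw', fun τ => (F.exact_succ k _).1 ?_⟩, hlift⟩
    · have h1 := h0 τ h
      obtain ⟨v, hv, hne⟩ := Finset.exists_ne_zero_of_sum_ne_zero h1
      have := hcard _ (right_ne_zero_of_smul hne)
      rw [Finset.card_insert_of_notMem (Finset.mem_compl.1 hv)] at this
      omega
    · rw [map_d]
      simp only [Matrix.mulVecLin_apply]
      rw [funext hlift]
      exact d_d w τ
  choose next hnext using step
  let w : ∀ k, {w // Q k w} := fun k => Nat.rec ⟨w₀, hw₀⟩ next k
  have hw : ∀ k τ, (F.diff k).mulVec ((w (k + 1)).1 τ) = d K (w k).1 τ := fun k => hnext k (w k)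
  have mulVec_d : ∀ k (y : Finset V → Fin (F.rank (k + 1)) → MvPolynomial V K) τ,
      (F.diff k).mulVec (d K y τ) = d K (fun τ => (F.diff k).mulVec (y τ)) τ := fun k y τ =>
    map_d (F.diff k).mulVecLin y τ
  have diff_diff : ∀ k p, (F.diff k).mulVec ((F.diff (k + 1)).mulVec p) = 0 := fun k p =>
    (F.exact_succ k _).2 ⟨p, rfl⟩
  -- Descending induction on k from m + 1, where w_k = 0. Once w_{k+1} is decomposed, w_k minus a
  -- boundary of F is a Koszul cycle, hence exact.
  have back : ∀ j k, k + j = m + 1 → ∃ (y : Finset V → Fin (F.rank k) → MvPolynomial V K)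
      (y' : Finset V → Fin (F.rank (k + 1)) → MvPolynomial V K),
      ∀ τ, (w k).1 τ = (F.diff k).mulVec (y' τ) + d K y τ := by
    intro j
    induction j with
    | zero =>
      intro k hk
      refine ⟨0, 0, fun τ => ?_⟩
      have h0 : (w k).1 τ = 0 := by
        by_contra h
        have := (w k).2.1 τ h
        omega
      simp [h0, d]
    | succ j ih =>
      intro k hk
      obtain ⟨y', y'', hy⟩ := ih (k + 1) (by omega)
      obtain ⟨y, hy'⟩ := exists_d_eq_of_vec
        (f := fun τ => (w k).1 τ - (F.diff k).mulVec (y' τ)) (fun τ => by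
          rw [d_sub, ← hw, ← mulVec_d, hy, Matrix.mulVec_add, diff_diff, zero_add, sub_self])
        (fun b => by
          rw [Pi.sub_apply, map_sub, Matrix.mulVec, dotProduct, map_sum]
          simp only [map_mul, F.minimal, zero_mul, Finset.sum_const_zero, sub_zero]
          -- A nonzero constant term at ∅ forces k = m and a generator of F_m of degree n, which
          -- exceeds m + r since the original homological degree is m + 1.
          by_contra h
          have h1 := (w k).2.1 ∅ fun h' => h (by rw [h']; simp)
          have h2 := (w k).2.2.1 ∅ b 0 h
          have h3 := hF k b
          simp at h1 h2
          omega)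
      exact ⟨y, y', fun τ => by rw [hy']; abel⟩
  obtain ⟨y, y', hy⟩ := back (m + 1) 0 (zero_add _)
  have hεd : ∀ p, ε ((F.diff 0).mulVec p) = 0 := fun p => (F.exact_zero _).2 ⟨p, rfl⟩
  -- Correcting z by ε y, which lies in I, gives a genuine Koszul cycle over the polynomial ring.
  refine ⟨homotopy fun τ => z τ - ε (y τ), fun τ => ?_⟩
  rw [d_homotopy]
  · simpa using hε (y τ)
  · intro τ
    rw [d_sub, ← hεw]
    have : (w 0).1 τ = w₀ τ := rfl
    rw [← this, hy, map_add, hεd, zero_add, map_d, sub_self]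
  · rw [map_sub, hI _ (hε _), sub_zero]
    have : z ∅ = 0 := by
      by_contra h
      simpa using hz ∅ h
    simp [this]

end Koszul

/-! ### Signs of the detecting functional -/

namespace Koszul

variable {V K : Type*} [LinearOrder V] [CommRing K]

variable (K) in
/-- The sign of the edge `{u, v}` of a cycle with vertex set `W`, traversed from `u` to `v`, in
the cocycle which detects the cycle. -/
def edgeSign (W : Finset V) (u v : V) : K :=
  (-1) ^ pos u W * (-1) ^ pos v W * if v < u then -1 else 1

theorem neg_one_pow_mul_self (k : ℕ) : ((-1 : K) ^ k) * (-1) ^ k = 1 := by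
  rw [← mul_pow]
  simp

theorem neg_one_pow_pos_erase_erase {W : Finset V} {u v : V} (hu : u ∈ W) (hv : v ∈ W)
    (huv : u ≠ v) :
    (-1 : K) ^ pos u ((W.erase u).erase v) =
      (-1) ^ pos u W * if v < u then -1 else 1 := by
  have h1 : pos u W = pos u (W.erase u) := by
    conv_lhs => rw [← Finset.insert_erase hu, pos_insert (Finset.notMem_erase u W),
      if_neg (lt_irrefl u), add_zero]
  have h2 := pos_insert (u := u) (Finset.notMem_erase v (W.erase u))
  rw [Finset.insert_erase (Finset.mem_erase.2 ⟨huv.symm, hv⟩)] at h2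
  rw [h1, h2]
  split_ifs
  · rw [pow_succ]
    ring
  · rw [add_zero, mul_one]

/-- With `edgeSign_mul_right`, this makes the contribution of an edge to a boundary a difference of
two terms, each depending on one end only. -/
theorem edgeSign_mul_left {W : Finset V} {u v : V} (hu : u ∈ W) (hv : v ∈ W) (huv : u ≠ v) :
    edgeSign K W u v * (-1) ^ pos u ((W.erase u).erase v) = (-1) ^ pos v W := by
  rw [neg_one_pow_pos_erase_erase hu hv huv, edgeSign]
  have h1 := neg_one_pow_mul_self (K := K) (pos u W)
  split_ifs
  · linear_combination (-1) ^ pos v W * h1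
  · linear_combination (-1) ^ pos v W * h1

theorem edgeSign_mul_right {W : Finset V} {u v : V} (hu : u ∈ W) (hv : v ∈ W) (huv : u ≠ v) :
    edgeSign K W u v * (-1) ^ pos v ((W.erase u).erase v) = -(-1) ^ pos u W := by
  rw [Finset.erase_right_comm, neg_one_pow_pos_erase_erase hv hu huv.symm, edgeSign]
  have h1 := neg_one_pow_mul_self (K := K) (pos v W)
  rcases lt_or_gt_of_ne huv with h | h
  · rw [if_neg h.not_gt, if_pos h]
    linear_combination -(-1) ^ pos u W * h1
  · rw [if_pos h, if_neg h.not_gt]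
    linear_combination -(-1) ^ pos u W * h1

end Koszul

/-! ### Induced cycles obstruct linearity -/

namespace SimpleGraph

open Koszul

variable {V K : Type*} [Field K] {G : SimpleGraph V}

/-- The exponent of the monomial `x_u x_v`. -/
noncomputable def pairExp (u v : V) : V →₀ ℕ := Finsupp.single u 1 + Finsupp.single v 1

theorem pairExp_apply_ne_zero {u v w : V} : pairExp u v w ≠ 0 ↔ w = u ∨ w = v := by
  classical
  simp only [pairExp, Finsupp.add_apply, Finsupp.single_apply]
  split_ifs <;> simp_all [eq_comm]

theorem coeff_pairExp_eq_zero {u v : V} (huv : G.Adj u v) {p : MvPolynomial V K}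
    (hp : p ∈ G.circuitIdeal K) : coeff (pairExp u v) p = 0 := by
  by_contra h
  obtain ⟨a, b, hab, hle⟩ := mem_circuitIdeal.1 hp _ h
  have key : ∀ c, pairExp a b c ≠ 0 → c = u ∨ c = v := fun c hc =>
    pairExp_apply_ne_zero.1 fun h0 => hc (Nat.le_zero.1 (h0 ▸ hle c))
  rcases key a (pairExp_apply_ne_zero.2 (Or.inl rfl)) with rfl | rfl <;>
    rcases key b (pairExp_apply_ne_zero.2 (Or.inr rfl)) with rfl | rfl
  · exact hab.1 rfl
  · exact hab.2 huv
  · exact hab.2 huv.symm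
  · exact hab.1 rfl

theorem constantCoeff_of_mem_circuitIdeal {p : MvPolynomial V K} (hp : p ∈ G.circuitIdeal K) :
    constantCoeff p = 0 := by
  by_contra h
  obtain ⟨a, b, -, hle⟩ := mem_circuitIdeal.1 hp 0 h
  have := hle a
  simp at this

/-- Only inserting u or v can produce the monomial x_u x_v. The result is a difference of vertex
values, so it telescopes around a cycle. -/
theorem coeff_d_pairExp [LinearOrder V] [Fintype V] (t : Finset V → MvPolynomial V K)
    {W : Finset V} {u v : V} (hu : u ∈ W) (hv : v ∈ W) (huv : u ≠ v) :
    edgeSign K W u v * coeff (pairExp u v) (d K t ((W.erase u).erase v)) =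
      (-1) ^ pos v W * coeff (Finsupp.single v 1) (t (W.erase v)) -
        (-1) ^ pos u W * coeff (Finsupp.single u 1) (t (W.erase u)) := by
  have h1 : ∀ w, (pairExp u v w ≠ 0) = (w = u ∨ w = v) := fun w =>
    propext pairExp_apply_ne_zero
  rw [coeff_d]
  simp only [h1]
  rw [← Finset.sum_filter]
  have h2 : (((W.erase u).erase v)ᶜ.filter fun w => w = u ∨ w = v) = {u, v} := by
    ext w
    simp only [Finset.mem_filter, Finset.mem_compl, Finset.mem_erase, Finset.mem_insert,
      Finset.mem_singleton]
    tauto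
  rw [h2, Finset.sum_pair huv, Finset.insert_erase (Finset.mem_erase.2 ⟨huv.symm, hv⟩),
    Finset.erase_right_comm, Finset.insert_erase (Finset.mem_erase.2 ⟨huv, hu⟩),
    Finset.erase_right_comm, mul_add, ← mul_assoc, ← mul_assoc, edgeSign_mul_left hu hv huv,
    edgeSign_mul_right hu hv huv, pairExp, add_tsub_cancel_left, add_tsub_cancel_right]
  ring

theorem not_hasRegularity_circuitIdeal [Finite V] {n : ℕ} (hn : 3 < n)
    (f : cycleGraph n ↪g G) : ¬ HasRegularity (G.circuitIdeal K) 2 := by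
  classical
  rintro ⟨F, hF⟩
  cases nonempty_fintype V
  -- Any order will do; it only fixes the Koszul signs.
  let _ : LinearOrder V := LinearOrder.lift' (Fintype.equivFin V) (Fintype.equivFin V).injective
  obtain ⟨k, rfl⟩ : ∃ k, n = k + 4 := ⟨n - 4, by omega⟩
  have hdeg : ∀ i b, F.deg i b ≤ i + 2 := fun i b => by
    have := hF.1 ⟨i, F.deg i b, Finset.card_ne_zero.2 ⟨b, by simp⟩, rfl⟩
    omega
  have inj : ∀ {i j}, f i = f j → i = j := fun h => f.injective h
  let W : Finset V := Finset.univ.map f.toEmbedding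
  have hW : ∀ i, f i ∈ W := fun i => Finset.mem_map_of_mem _ (Finset.mem_univ i)
  have hadj : ∀ i, G.Adj (f i) (f (i + 1)) := fun i =>
    f.map_adj_iff.2 (cycleGraph_adj.2 (Or.inr (add_sub_cancel_left i 1)))
  let τ₀ : Finset V := (W.erase (f 0)).erase (f 1)
  have h01 : G.Adj (f 0) (f 1) := by simpa using hadj 0
  have hτ₀ : τ₀.card = k + 2 := by
    rw [Finset.card_erase_of_mem (Finset.mem_erase.2 ⟨h01.ne', hW 1⟩),
      Finset.card_erase_of_mem (hW 0), Finset.card_map, Finset.card_univ, Fintype.card_fin]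
    omega
  let z : Finset V → MvPolynomial V K := fun τ =>
    if τ = τ₀ then monomial (pairExp (f 0) (f 1)) 1 else 0
  have hz : ∀ τ, z τ ≠ 0 → τ = τ₀ := fun τ h => by
    by_contra h'
    exact h (if_neg h')
  -- The internal degree k + 4 is exactly m + 2, the least one that the bound covers.
  obtain ⟨t, ht⟩ := exists_sub_d_mem F (m := k + 2) (n := k + 4) hdeg le_rfl (by omega)
    (fun p hp => constantCoeff_of_mem_circuitIdeal hp) (z := z)
    (fun τ h => by rw [hz τ h, hτ₀])
    (fun τ a ha => by
      obtain rfl := hz τ fun h => ha (by rw [h, coeff_zero])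
      simp only [z, if_true, coeff_monomial] at ha
      obtain rfl : pairExp (f 0) (f 1) = a := by
        by_contra h
        exact ha (if_neg h)
      rw [hτ₀, pairExp, map_add, Finsupp.degree_single, Finsupp.degree_single]
      omega)
    (fun τ => by
      refine Ideal.sum_mem _ fun v hv => ?_
      by_cases h0 : z (insert v τ) = 0
      · rw [h0, smul_zero]
        exact Ideal.zero_mem _
      have hins := hz _ h0
      have hvτ : v ∈ τ₀ := hins ▸ Finset.mem_insert_self v τ
      simp only [τ₀, W, Finset.mem_erase, Finset.mem_map, Finset.mem_univ, true_and] at hvτ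
      obtain ⟨hv1, hv0, j, rfl : f j = v⟩ := hvτ
      have hj0 : (j : ℕ) ≠ 0 := fun h => hv0 (congrArg f (Fin.ext h))
      have hj1 : (j : ℕ) ≠ 1 := fun h => hv1 (congrArg f (Fin.ext h))
      have hmon : (monomial (pairExp (f 0) (f 1)) 1 : MvPolynomial V K) = X (f 0) * X (f 1) := by
        simp [pairExp, X, monomial_mul]
      simp only [z, hins, if_true, hmon, entry, smul_eq_mul]
      -- A cycle of length at least 4 has no triangle, so each term of the differential of z is
      -- divisible by a non-edge monomial.
      have hcase : ¬ G.Adj (f 0) (f j) ∨ ¬ G.Adj (f 1) (f j) := by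
        by_contra! h
        rw [f.map_adj_iff, f.map_adj_iff,
          cycleGraph_adj_iff_of_lt (by rw [Fin.lt_def, Fin.val_zero]; omega),
          cycleGraph_adj_iff_of_lt (by rw [Fin.lt_def, Fin.val_one]; omega), Fin.val_zero,
          Fin.val_one] at h
        omega
      rcases hcase with h | h
      · have := X_mul_X_mem_circuitIdeal (K := K) (G := G) ⟨Ne.symm hv0, h⟩
        have h' := Ideal.mul_mem_left _ ((-1) ^ pos (f j) τ * X (f 1)) this
        convert h' using 1
        ring
      · have := X_mul_X_mem_circuitIdeal (K := K) (G := G) ⟨Ne.symm hv1, h⟩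
        have h' := Ideal.mul_mem_left _ ((-1) ^ pos (f j) τ * X (f 0)) this
        convert h' using 1
        ring)
  have key : ∀ i, edgeSign K W (f i) (f (i + 1)) *
      coeff (pairExp (f i) (f (i + 1))) (z ((W.erase (f i)).erase (f (i + 1)))) =
      (-1) ^ pos (f (i + 1)) W * coeff (Finsupp.single (f (i + 1)) 1) (t (W.erase (f (i + 1)))) -
        (-1) ^ pos (f i) W * coeff (Finsupp.single (f i) 1) (t (W.erase (f i))) := fun i => by
    have h := coeff_pairExp_eq_zero (hadj i) (ht ((W.erase (f i)).erase (f (i + 1))))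
    rw [coeff_sub, sub_eq_zero] at h
    rw [h, coeff_d_pairExp t (hW i) (hW (i + 1)) (hadj i).ne]
  -- Around the cycle the right-hand sides cancel, while on the left only the edge i = 0
  -- contributes, with value ±1.
  have hsum := Finset.sum_congr rfl fun i (_ : i ∈ Finset.univ) => key i
  have hshift := Equiv.sum_comp (Equiv.addRight (1 : Fin (k + 4)))
    fun i => (-1 : K) ^ pos (f i) W * coeff (Finsupp.single (f i) 1) (t (W.erase (f i)))
  simp only [Equiv.coe_addRight] at hshift
  rw [Finset.sum_sub_distrib, hshift, sub_self, Finset.sum_eq_single_of_mem 0 (Finset.mem_univ _)] at hsum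
  · simp only [zero_add, z, τ₀, if_true, coeff_monomial, mul_one, edgeSign] at hsum
    split_ifs at hsum <;> simp at hsum
  · intro i _ hi
    have h2 : pairExp (f 0) (f 1) ≠ pairExp (f i) (f (i + 1)) := fun h => by
      have h3 : ∀ l, l = i ∨ l = i + 1 → l = 0 ∨ l = 1 := fun l hl => by
        have := pairExp_apply_ne_zero.2 (hl.imp (congrArg f) (congrArg f))
        rw [← h] at this
        exact (pairExp_apply_ne_zero.1 this).imp inj inj
      have h4 := (h3 i (Or.inl rfl)).resolve_left hi
      subst h4
      have h5 := (h3 (1 + 1) (Or.inr rfl)).imp (congrArg Fin.val) (congrArg Fin.val)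
      rw [Fin.val_add, Fin.val_one, Fin.val_zero, Nat.mod_eq_of_lt (by omega)] at h5
      omega
    simp only [z]
    split_ifs
    · rw [coeff_monomial, if_neg h2, mul_zero]
    · rw [coeff_zero, mul_zero]

theorem isMinimalToTwoLinearity_cycleGraph {n : ℕ} (hn : 3 < n) :
    (cycleGraph n).IsMinimalToTwoLinearity K := by
  refine ⟨fun h => not_hasRegularity_circuitIdeal hn Embedding.refl h.1, fun H hH => ?_,
    hasDimension_cliqueComplex_cycleGraph hn⟩
  exact (isChordal_of_lt_cycleGraph hn hH).hasLinearResolution (hH.trans_le le_top).ne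

theorem IsChordal.top : (⊤ : SimpleGraph V).IsChordal := by
  refine isChordal_iff_isEmpty_embedding.2 fun n hn => ⟨fun f => ?_⟩
  have h : (cycleGraph n).Adj ⟨0, by omega⟩ ⟨2, by omega⟩ :=
    f.map_adj_iff.1 (f.injective.ne (by simp [Fin.ext_iff]))
  rw [cycleGraph_adj_iff_of_lt (by simp [Fin.lt_def])] at h
  simp at h
  omega

theorem not_isChordal_iff :
    ¬ G.IsChordal ↔ ∃ n : ℕ, 3 < n ∧ Nonempty (cycleGraph n ↪g G) := by
  rw [isChordal_iff_isEmpty_embedding]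
  simp

end SimpleGraph

theorem mainTheorem7 (K : Type*) [Field K] {V : Type*} [Finite V] (G : SimpleGraph V) :
    -- the equivalence; for a complete graph the ideal is zero, and the graph is chordal
    (G ≠ ⊤ → (HasLinearResolution (G.circuitIdeal K) 2 ↔ G.IsChordal)) ∧
    (G = ⊤ → G.circuitIdeal K = ⊥ ∧ G.IsChordal) ∧
    -- non-chordal graphs are those with an induced cycle of length greater than three
    (¬ G.IsChordal ↔ ∃ n : ℕ, 3 < n ∧ Nonempty (SimpleGraph.cycleGraph n ↪g G)) ∧
    -- these cycles are minimal to 2-linearity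
    (∀ n : ℕ, 3 < n → (SimpleGraph.cycleGraph n).IsMinimalToTwoLinearity K) ∧
    -- a chordal graph which is not complete decomposes along a clique into chordal graphs
    (G.IsChordal → G ≠ ⊤ → ∃ A B : Set V, G.IsCliqueDecomposition A B ∧
      (G.induce A).IsChordal ∧ (G.induce B).IsChordal) := by
  refine ⟨fun h => ⟨fun hlin => ?_, fun hG => hG.hasLinearResolution h⟩, ?_,
    SimpleGraph.not_isChordal_iff,
    fun n hn => SimpleGraph.isMinimalToTwoLinearity_cycleGraph hn, fun hG h => ?_⟩
  · by_contra hG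
    obtain ⟨n, hn, ⟨f⟩⟩ := SimpleGraph.not_isChordal_iff.1 hG
    exact SimpleGraph.not_hasRegularity_circuitIdeal hn f hlin.1
  · rintro rfl
    exact ⟨SimpleGraph.circuitIdeal_top, SimpleGraph.IsChordal.top⟩
  · obtain ⟨A, B, hAB⟩ := hG.exists_isCliqueDecomposition h
    exact ⟨A, B, hAB, hG.of_embedding (SimpleGraph.Embedding.induce A),
      hG.of_embedding (SimpleGraph.Embedding.induce B)⟩
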